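/- Let $q$ be a prime power, let $\mathbb{F}_q$ be the field with $q$ elements, let $K=\overline{\mathbb{F}}_q$, and let $Z=\mathbb{P}^3(\mathbb{F}_q)\subseteq\mathbb{P}^3_K$ be the set of $\mathbb{F}_q$-rational points. Definitions. A property holds for a general point $P$ if it holds for all $P$ in some nonempty Zariski open subset of $\mathbb{P}^3_K$. A finite set $Y$ in a plane $H=V(h)\subset\mathbb{P}^3_K$ is the complete intersection in $H$ of two forms $F,G$ of degrees $a,b$ if the homogeneous ideal of $Y$ is $(h,F,G)$. For positive integers $a,b$, a finite set in $\mathbb{P}^3_K$ is $\{a,b\}$-geproci if, for a general point $P$ and every plane $H\not\ni P$, its projection from $P$ to $H$ is a complete intersection in $H$ of forms of degrees $a$ and $b$; it is called $(a,b)$-geproci if moreover $a\le b$. An $(a,b)$-grid is the set of intersection points of $a$ pairwise disjoint lines with $b$ pairwise disjoint lines, where every line of the first family meets every line of the second in exactly one point. A set is nontrivial if it is neither contained in a plane nor a grid. A $\{\mu,\lambda\}$-half grid is a nontrivial $\{\mu,\lambda\}$-geproci set contained in the union of $\mu$ mutually skew lines, each of which contains exactly $\lambda$ of its points. A spread of $\mathbb{P}^3_{\mathbb{F}_q}$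 is a set of lines defined over $\mathbb{F}_q$ such that each $\mathbb{F}_q$-point lies on exactly one of them. A cone of degree $d$ with vertex $P$ is given by a nonzero form of degree $d$ having multiplicity $d$ at $P$. **Theorem.** $Z$ is $(q+1,q^2+1)$-geproci, and it is a half grid: a $\{q^2+1,q+1\}$-half grid, covered by $q^2+1$ mutually skew lines with exactly $q+1$ points of $Z$ on each. Moreover, spreads of $\mathbb{P}^3_{\mathbb{F}_q}$ exist, and every spread $S$ consists of $q^2+1$ lines. For every spread $S$ and a general point $P=(a,b,c,d)\in\mathbb{P}^3_K$ the following hold. 1. The determinant $$F=\det\begin{pmatrix}a&b&c&d\\a^q&b^q&c^q&d^q\\x&y&z&w\\x^q&y^q&z^q&w^q\end{pmatrix}$$ defines a cone of degree $q+1$ with vertex $P$ that contains $Z$. 2. There is a form $G$ that defines a cone of degree $q^2+1$ with vertex $P$ that contains $Z$, and the zero locus of $G$ is the join of $P$ with the lines of $S$, that is, the union of the planes spanned by $P$ and a line of $S$ (extended to $K$). 3. For every plane $H\subset\mathbb{P}^3_K$ not containing $P$, the projection of $Z$ from $P$ to $H$ is the complete intersection in $H$ of $F$ and $G$. -/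

import Mathlib

namespace Geproci

/-- Projective 3-space over a field `K`, as a set of points. -/
abbrev P3 (K : Type*) [Field K] := Projectivization K (Fin 4 → K)

/-- The homogeneous coordinate ring of projective 3-space. -/
abbrev CoordRing (K : Type*) [Field K] := MvPolynomial (Fin 4) K

section Defs

variable {K : Type*} [Field K]

/-- A form vanishes at a point. (For a homogeneous `f` this does not depend on the representative.) -/
def VanishesAt (f : CoordRing K) (p : P3 K) : Prop :=
  MvPolynomial.eval p.rep f = 0

/-- The homogeneous ideal of a set of points: the ideal generated by all forms
vanishing at every point of the set. -/
noncomputable def homogeneousIdeal (Z : Set (P3 K)) : Ideal (CoordRing K) :=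
  Ideal.span {f | (∃ d : ℕ, f.IsHomogeneous d) ∧ ∀ p ∈ Z, VanishesAt f p}

/-- Zariski closed subsets of projective 3-space: common zero loci of forms. -/
def IsZariskiClosed (C : Set (P3 K)) : Prop :=
  ∃ T : Set (CoordRing K),
    (∀ f ∈ T, ∃ d : ℕ, f.IsHomogeneous d) ∧ C = {p | ∀ f ∈ T, VanishesAt f p}

/-- A property holds for a general point if it holds on a nonempty Zariski open subset. -/
def ForGeneralPoint (prop : P3 K → Prop) : Prop :=
  ∃ C : Set (P3 K), IsZariskiClosed C ∧ C ≠ Set.univ ∧ ∀ P : P3 K, P ∉ C → prop P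

/-- A linear subspace of projective 3-space is given by a vector subspace of `K ^ 4`;
this is incidence of a point with it. -/
def LiesOn (p : P3 K) (W : Submodule K (Fin 4 → K)) : Prop := p.submodule ≤ W

/-- A line of projective 3-space, as a 2-dimensional vector subspace. -/
def IsLine (l : Submodule K (Fin 4 → K)) : Prop := Module.finrank K l = 2

/-- The projection of `Z` from the point `P` to the plane with equation `h = 0`, where the plane
does not contain `P`: the points of the plane on the lines joining `P` to points of `Z`. -/
def projection (P : P3 K) (h : CoordRing K) (Z : Set (P3 K)) : Set (P3 K) :=
  {R | VanishesAt h R ∧ ∃ Q ∈ Z, LiesOn R (P.submodule ⊔ Q.submodule)}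

/-- The forms `F` and `G` of degrees `a` and `b` cut out the set `Y` in the plane `h = 0`
as a complete intersection: modulo `h` they generate the homogeneous ideal of `Y`. -/
def IsPlaneCompleteIntersectionOf (h : CoordRing K) (Y : Set (P3 K)) (a b : ℕ)
    (F G : CoordRing K) : Prop :=
  F.IsHomogeneous a ∧ G.IsHomogeneous b ∧ homogeneousIdeal Y = Ideal.span {h, F, G}

/-- `Z` is `{a, b}`-geproci: the projection of the finite set `Z` from a general point to a plane is
a complete intersection, in that plane, of a curve of degree `a` and a curve of degree `b`. -/
def IsGeproci (Z : Set (P3 K)) (a b : ℕ) : Prop :=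
  Z.Finite ∧ 0 < a ∧ 0 < b ∧
    ForGeneralPoint fun P : P3 K =>
      ∀ h : CoordRing K, h.IsHomogeneous 1 → ¬ VanishesAt h P →
        ∃ F G : CoordRing K, IsPlaneCompleteIntersectionOf h (projection P h Z) a b F G

/-- `Z` is an `(a, b)`-grid: the set of the intersection points of `a` pairwise disjoint lines
with `b` pairwise disjoint lines, each line of the first family meeting each line of the
second one in a point. -/
def IsGrid (Z : Set (P3 K)) (a b : ℕ) : Prop :=
  ∃ A B : Finset (Submodule K (Fin 4 → K)),
    A.card = a ∧ B.card = b ∧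
    (∀ l ∈ A, IsLine l) ∧ (∀ m ∈ B, IsLine m) ∧
    (∀ l ∈ A, ∀ l' ∈ A, l ≠ l' → Disjoint l l') ∧
    (∀ m ∈ B, ∀ m' ∈ B, m ≠ m' → Disjoint m m') ∧
    (∀ l ∈ A, ∀ m ∈ B, Module.finrank K (l ⊓ m : Submodule K (Fin 4 → K)) = 1) ∧
    Z = {p | ∃ l ∈ A, ∃ m ∈ B, LiesOn p l ∧ LiesOn p m}

/-- `Z` is contained in a plane. -/
def IsCoplanar (Z : Set (P3 K)) : Prop :=
  ∃ W : Submodule K (Fin 4 → K), Module.finrank K W = 3 ∧ ∀ p ∈ Z, LiesOn p W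

/-- `Z` is nontrivial: neither coplanar nor a grid. -/
def IsNontrivial (Z : Set (P3 K)) : Prop :=
  ¬ IsCoplanar Z ∧ ∀ a b : ℕ, ¬ IsGrid Z a b

/-- `Z` is a `{μ, l}`-half grid: a nontrivial `{μ, l}`-geproci set contained in the union of
`μ` mutually skew lines, each of which contains exactly `l` points of `Z`. -/
def IsHalfGrid (Z : Set (P3 K)) (μ l : ℕ) : Prop :=
  IsNontrivial Z ∧ IsGeproci Z μ l ∧
    ∃ A : Finset (Submodule K (Fin 4 → K)),
      A.card = μ ∧ (∀ m ∈ A, IsLine m) ∧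
      (∀ m ∈ A, ∀ m' ∈ A, m ≠ m' → Disjoint m m') ∧
      (∀ p ∈ Z, ∃ m ∈ A, LiesOn p m) ∧
      (∀ m ∈ A, {p | p ∈ Z ∧ LiesOn p m}.ncard = l)

/-- `F` is the equation of a cone of degree `d` with vertex `P`: a nonzero form of degree `d`
with multiplicity `d` at `P`. -/
def IsCone (F : CoordRing K) (P : P3 K) (d : ℕ) : Prop :=
  F ≠ 0 ∧ F.IsHomogeneous d ∧ F ∈ homogeneousIdeal {P} ^ d

/-- The determinant of the matrix with rows `v`, `v ^ q`, `(x, y, z, w)`,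
`(x ^ q, y ^ q, z ^ q, w ^ q)`, as a polynomial in `x, y, z, w`. -/
noncomputable def mooreForm (q : ℕ) (v : Fin 4 → K) : CoordRing K :=
  Matrix.det (Matrix.of
    ![fun i => MvPolynomial.C (v i), fun i => MvPolynomial.C (v i ^ q),
      fun i => MvPolynomial.X i, fun i => MvPolynomial.X i ^ q])

/-- A spread of projective 3-space: a set of lines such that every point lies on
one and only one of them. -/
def IsSpread (S : Set (Submodule K (Fin 4 → K))) : Prop :=
  (∀ l ∈ S, IsLine l) ∧ ∀ p : P3 K, ∃! l, l ∈ S ∧ LiesOn p l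

end Defs

section Extension

variable (k K : Type*) [Field k] [Field K] [Algebra k K]

/-- The `k`-rational points of projective 3-space over `K`. -/
def rationalPoints : Set (P3 K) :=
  {p | ∃ (v : Fin 4 → k) (hv : (fun i => algebraMap k K (v i)) ≠ 0),
    p = Projectivization.mk K (fun i => algebraMap k K (v i)) hv}

variable {k}

/-- The linear subspace over `K` spanned by a linear subspace over `k`. -/
def extend (l : Submodule k (Fin 4 → k)) : Submodule K (Fin 4 → K) :=
  Submodule.span K ((fun (v : Fin 4 → k) (i : Fin 4) => algebraMap k K (v i)) '' (l : Set (Fin 4 → k)))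

variable {K}

/-- The join of the point `P` with the lines in `S`: the union of the
linear spaces spanned by `P` and a line of `S`. -/
def join (P : P3 K) (S : Set (Submodule k (Fin 4 → k))) : Set (P3 K) :=
  {Q | ∃ l ∈ S, LiesOn Q (P.submodule ⊔ extend K l)}

end Extension

end Geproci

/-! Let `P` be a point on no plane defined over `k`. There are finitely many such planes, so a
general point qualifies (`forGeneralPoint_of_isGeneric`). Frobenius is additive and fixes `k`, so
the Moore form `F` is invariant under translation by multiples of `P.rep` and vanishes on rational
vectors. For a spread `S`, let `G` be the product of the equations of the planes joining `P` to the
lines of `S`. Both are cones through all rational points, and counting nonzero vectors gives `|S| =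
q ^ 2 + 1`.

The substance is that `h`, `F`, `G` generate the whole homogeneous ideal of the projected set. The
factors of `G` cut the plane `h = 0` in `q ^ 2 + 1` lines, each carrying the `q + 1` projections of
the rational points of one line of `S`. As `q + 1` is the degree of `F`, and `F` is not identically
zero on such a line (`IsGeneric.exists_eval_mooreForm_ne_zero`), `F` generates there the ideal of
these points (`exists_eval_eq_mul_of_eval_points`). A polynomial vanishing at all projected points
is thus, on the first line, a multiple of `F`; subtracting this multiple leaves something divisible,
modulo `h`, by the equation of the line, and the quotient still vanishes at the points of the other
lines. Iterating (`exists_eval_eq_add_prod_mul`) ends with a combination of `F` and `G` modulo `h`.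
Ideal membership is handled through values of polynomials, which suffices since `K` is infinite.

Spreads come from the points of a projective line over the quadratic extension of `k`, and extending
their lines to `K` gives the half grid. A grid is excluded by counting: its lines would be rational
with `q + 1` points each, giving at most `(q + 1) ^ 2` points in all. -/

namespace Geproci

open MvPolynomial

/-! ### Polynomial functions on lines and planes -/

section LinearForms

variable {K : Type*} [Field K] {n : Type*}

lemma eval_aeval (x : n → K) (g : n → MvPolynomial n K) (u : MvPolynomial n K) :
    eval x (aeval g u) = eval (fun i => eval x (g i)) u := by
  simp only [← coe_aeval_eq_eval, RingHom.coe_coe]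
  exact comp_aeval_apply _ _ _

lemma eval_smul_of_isHomogeneous {f : MvPolynomial n K} {d : ℕ} (hf : f.IsHomogeneous d)
    (t : K) (x : n → K) : eval (t • x) f = t ^ d * eval x f := by
  rw [eval_eq, eval_eq, Finset.mul_sum]
  refine Finset.sum_congr rfl fun m hm => ?_
  have hd : ∑ i ∈ m.support, m i = d := (hf.degree_eq_sum_deg_support hm).symm
  simp only [Pi.smul_apply, smul_eq_mul, mul_pow, Finset.prod_mul_distrib,
    Finset.prod_pow_eq_pow_sum, hd]
  ring

/-- A polynomial that is constant along a punctured line through the origin takes the same value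
at the origin. -/
lemma eval_zero_of_eval_smul [Infinite K] (u : MvPolynomial n K) (w : n → K) (a : K)
    (h : ∀ t : K, t ≠ 0 → eval (t • w) u = a) : eval 0 u = a := by
  -- The restriction of `u` to the line `t ↦ t • w`; it takes the value `a` infinitely often, so it
  -- is constant.
  set p : Polynomial K := aeval (fun i => Polynomial.C (w i) * Polynomial.X) u with hp
  have ev : ∀ t : K, p.eval t = eval (t • w) u := by
    intro t
    rw [hp, ← Polynomial.coe_aeval_eq_eval, comp_aeval_apply, ← coe_aeval_eq_eval]
    simp only [map_mul, Polynomial.aeval_C, Polynomial.aeval_X, RingHom.coe_coe]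
    congr 2
    funext i
    simp [mul_comm]
  have h0 : p - Polynomial.C a = 0 := by
    apply Polynomial.eq_zero_of_infinite_isRoot
    refine Set.Infinite.mono (s := {0}ᶜ) ?_ (Set.finite_singleton (0 : K)).infinite_compl
    intro t ht
    simp [Polynomial.IsRoot, ev, h t ht]
  have := ev 0
  rw [sub_eq_zero.1 h0] at this
  simpa using this.symm

/-- Substituting elements of an ideal into a form of degree `d` gives an element of the `d`-th
power of the ideal. -/
lemma aeval_mem_pow {R : Type*} [CommRing R] [Algebra K R] (I : Ideal R) (g : n → R)
    (hg : ∀ i, g i ∈ I) {d : ℕ} {f : MvPolynomial n K} (hf : f.IsHomogeneous d) :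
    aeval g f ∈ I ^ d := by
  rw [aeval_def, eval₂_eq]
  refine Ideal.sum_mem _ fun m hm => Ideal.mul_mem_left _ _ ?_
  have hd : ∑ i ∈ m.support, m i = d := (hf.degree_eq_sum_deg_support hm).symm
  rw [← hd, ← Finset.prod_pow_eq_pow_sum]
  exact Ideal.prod_mem_prod fun i _ => Ideal.pow_mem_pow (hg i) _

variable [Fintype n]

/-- The linear form with given coefficients. -/
noncomputable def linForm (c : n → K) : MvPolynomial n K := ∑ i, C (c i) * X i

@[simp]
lemma eval_linForm (c x : n → K) : eval x (linForm c) = c ⬝ᵥ x := by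
  simp [linForm, dotProduct]

lemma isHomogeneous_linForm (c : n → K) : (linForm c).IsHomogeneous 1 :=
  IsHomogeneous.sum _ _ _ fun _ _ => isHomogeneous_C_mul_X _ _

lemma exists_eq_linForm {f : MvPolynomial n K} (hf : f.IsHomogeneous 1) :
    ∃ c : n → K, f = linForm c := by
  have h : f ∈ homogeneousSubmodule n K 1 := hf
  rw [homogeneousSubmodule_one_eq_span_X, Submodule.mem_span_range_iff_exists_fun] at h
  obtain ⟨c, rfl⟩ := h
  exact ⟨c, by simp [linForm, smul_eq_C_mul]⟩

/-- A polynomial vanishing on the hyperplane section of a subspace is, on this subspace, a multiple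
of the equation of the hyperplane. -/
lemma exists_eval_eq_mul (W : Submodule K (n → K)) (c : n → K) (u : MvPolynomial n K)
    (hu : ∀ x ∈ W, c ⬝ᵥ x = 0 → eval x u = 0) :
    ∃ r : MvPolynomial n K, ∀ x ∈ W, eval x u = (c ⬝ᵥ x) * eval x r := by
  by_cases hW : ∀ x ∈ W, c ⬝ᵥ x = 0
  · exact ⟨0, fun x hx => by simp [hu x hx (hW x hx)]⟩
  push Not at hW
  obtain ⟨v₀, hv₀, hcv₀⟩ := hW
  obtain ⟨v, hv, hcv⟩ : ∃ v ∈ W, c ⬝ᵥ v = 1 :=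
    ⟨(c ⬝ᵥ v₀)⁻¹ • v₀, W.smul_mem _ hv₀, by simp [dotProduct_smul, hcv₀]⟩
  -- `σ` is pullback along the projection `x ↦ x - (c ⬝ᵥ x) • v` onto the hyperplane. It is the
  -- identity modulo `linForm c`, and since `v ∈ W` the projection preserves `W`, so `σ u` vanishes
  -- on `W`.
  set σ : MvPolynomial n K →ₐ[K] MvPolynomial n K :=
    aeval fun i => X i - C (v i) * linForm c with hσ
  have hmem : u - σ u ∈ Ideal.span {linForm c} := by
    rw [← Ideal.Quotient.eq]
    have : (Ideal.Quotient.mkₐ K (Ideal.span {linForm c})) =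
        (Ideal.Quotient.mkₐ K (Ideal.span {linForm c})).comp σ := by
      ext i
      simp only [AlgHom.comp_apply, hσ, aeval_X, Ideal.Quotient.mkₐ_eq_mk]
      rw [Ideal.Quotient.eq, sub_sub_cancel]
      exact Ideal.mul_mem_left _ _ (Ideal.subset_span rfl)
    exact DFunLike.congr_fun this u
  obtain ⟨r, hr⟩ := Ideal.mem_span_singleton'.1 hmem
  refine ⟨r, fun x hx => ?_⟩
  have h1 : eval x (σ u) = 0 := by
    have : eval x (σ u) = eval (x - (c ⬝ᵥ x) • v) u := by
      rw [hσ, eval_aeval]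
      congr 2
      funext i
      simp [mul_comm]
    rw [this]
    refine hu _ (W.sub_mem hx (W.smul_mem _ hv)) ?_
    rw [dotProduct_sub, dotProduct_smul, hcv]
    simp
  have h2 := congrArg (eval x) hr
  rw [map_sub, h1, map_mul, eval_linForm, sub_zero] at h2
  rw [← h2, mul_comm]

lemma exists_eq_linForm_mul [Infinite K] (c : n → K) (u : MvPolynomial n K)
    (hu : ∀ x, c ⬝ᵥ x = 0 → eval x u = 0) : ∃ r, u = linForm c * r := by
  obtain ⟨r, hr⟩ := exists_eval_eq_mul ⊤ c u fun x _ => hu x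
  exact ⟨r, MvPolynomial.funext fun x => by simp [hr x trivial]⟩

/-- In a vector space of functions, a vector outside a line is separated from it by a linear
form. -/
lemma exists_dotProduct_eq_zero_ne_zero {p w : n → K} (h : w ∉ Submodule.span K {p}) :
    ∃ c : n → K, c ⬝ᵥ p = 0 ∧ c ⬝ᵥ w ≠ 0 := by
  classical
  obtain ⟨f, hf, hf'⟩ := Submodule.exists_dual_map_eq_bot_of_notMem h inferInstance
  obtain ⟨c, rfl⟩ := (dotProductEquiv K n).surjective f
  refine ⟨c, ?_, hf⟩
  have : (dotProductEquiv K n c) p ∈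
      Submodule.map (dotProductEquiv K n c) (Submodule.span K {p}) :=
    Submodule.mem_map_of_mem (Submodule.mem_span_singleton_self p)
  rw [hf'] at this
  exact (Submodule.mem_bot K).1 this

/-- A form whose degree is the number of points of a finite set on a projective line `W`, vanishing
at these points but not on `W`, generates on `W` the ideal of the set. -/
lemma exists_eval_eq_mul_of_eval_points [Infinite K] {J : Type*} [Fintype J]
    (W : Submodule K (n → K)) (hW : Module.finrank K W ≤ 2) (p : J → n → K)
    (hpW : ∀ j, p j ∈ W) (hp0 : ∀ j, p j ≠ 0)
    (hind : ∀ i j, i ≠ j → p i ∉ Submodule.span K {p j})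
    (F : MvPolynomial n K) (hF : F.IsHomogeneous (Fintype.card J))
    (hFp : ∀ j, eval (p j) F = 0) (w : n → K) (hw : w ∈ W) (hFw : eval w F ≠ 0)
    (u : MvPolynomial n K) (hu : ∀ j, ∀ t : K, eval (t • p j) u = 0) :
    ∃ r : MvPolynomial n K, ∀ x ∈ W, eval x u = eval x F * eval x r := by
  classical
  have hFt : ∀ j, ∀ t : K, eval (t • p j) F = 0 := fun j t => by
    rw [eval_smul_of_isHomogeneous hF, hFp, mul_zero]
  have hwp : ∀ j, w ∉ Submodule.span K {p j} := by
    intro j hj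
    obtain ⟨t, rfl⟩ := Submodule.mem_span_singleton.1 hj
    exact hFw (hFt j t)
  choose c hcp hcw using fun j => exists_dotProduct_eq_zero_ne_zero (hwp j)
  have hker : ∀ j, ∀ x ∈ W, c j ⬝ᵥ x = 0 → ∃ t : K, x = t • p j := by
    intro j x hx hcx
    have hspan : Submodule.span K {p j, w} = W := by
      apply Submodule.eq_of_le_of_finrank_le
      · rw [Submodule.span_le]
        rintro y (rfl | rfl)
        exacts [hpW j, hw]
      · have hli : LinearIndependent K ![p j, w] := by
          rw [LinearIndependent.pair_iff' (hp0 j)]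
          exact fun a ha => hwp j (Submodule.mem_span_singleton.2 ⟨a, ha⟩)
        have := finrank_span_eq_card hli
        rw [Matrix.range_cons_cons_empty] at this
        rw [this]
        simpa using hW
    rw [← hspan, Submodule.mem_span_pair] at hx
    obtain ⟨a, b, rfl⟩ := hx
    rw [dotProduct_add, dotProduct_smul, dotProduct_smul, hcp, smul_zero, zero_add,
      smul_eq_mul, mul_eq_zero] at hcx
    exact ⟨a, by rw [hcx.resolve_right (hcw j), zero_smul, add_zero]⟩
  have hcne : ∀ i j, i ≠ j → c j ⬝ᵥ p i ≠ 0 := by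
    intro i j hij h0
    obtain ⟨t, ht⟩ := hker j _ (hpW i) h0
    exact hind i j hij (Submodule.mem_span_singleton.2 ⟨t, ht.symm⟩)
  -- On `W` the product of the separating forms `c j` divides everything that vanishes at the
  -- points. It is applied both to `F` and to `u`.
  have key : ∀ (u : MvPolynomial n K), (∀ j, ∀ t : K, eval (t • p j) u = 0) → ∀ s : Finset J,
      ∃ r : MvPolynomial n K, ∀ x ∈ W, eval x u = (∏ j ∈ s, c j ⬝ᵥ x) * eval x r := by
    intro u hu s
    induction s using Finset.induction_on with
    | empty => exact ⟨u, by simp⟩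
    | insert j s hj ih =>
      obtain ⟨r, hr⟩ := ih
      have hrj : ∀ t : K, t ≠ 0 → eval (t • p j) r = 0 := by
        intro t ht
        have h1 := hr _ (W.smul_mem t (hpW j))
        rw [hu j t, eq_comm, mul_eq_zero] at h1
        refine h1.resolve_left ?_
        refine Finset.prod_ne_zero_iff.2 ?_
        intro i hi
        rw [dotProduct_smul, smul_eq_mul]
        exact mul_ne_zero ht (hcne j i (by rintro rfl; exact hj hi))
      -- At the origin the other factors may vanish, so cancellation says nothing there; the value
      -- follows from those at `t ≠ 0`.
      have hr0 : eval 0 r = 0 := eval_zero_of_eval_smul r (p j) 0 hrj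
      obtain ⟨r', hr'⟩ := exists_eval_eq_mul W (c j) r (by
        intro x hx hcx
        obtain ⟨t, rfl⟩ := hker j x hx hcx
        by_cases ht : t = 0
        · rw [ht, zero_smul, hr0]
        · exact hrj t ht)
      refine ⟨r', fun x hx => ?_⟩
      rw [hr x hx, hr' x hx, Finset.prod_insert hj]
      ring
  obtain ⟨g, hg⟩ := key F hFt Finset.univ
  obtain ⟨r, hr⟩ := key u hu Finset.univ
  -- The degree of `F` equals the number of factors, so the cofactor `g` is invariant under scaling
  -- and takes its value at the origin wherever the product is nonzero.
  have hconst : ∀ x ∈ W, eval x F = (∏ j, c j ⬝ᵥ x) * eval 0 g := by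
    intro x hx
    by_cases h0 : ∏ j, c j ⬝ᵥ x = 0
    · rw [hg x hx, h0, zero_mul, zero_mul]
    rw [eval_zero_of_eval_smul g x (eval x g), hg x hx]
    intro t ht
    have h1 := hg _ (W.smul_mem t hx)
    rw [eval_smul_of_isHomogeneous hF, hg x hx] at h1
    simp only [dotProduct_smul, smul_eq_mul, Finset.prod_mul_distrib, Finset.prod_const,
      Finset.card_univ] at h1
    rw [mul_assoc] at h1
    exact (mul_left_cancel₀ h0 (mul_left_cancel₀ (pow_ne_zero _ ht) h1)).symm
  have hg0 : eval 0 g ≠ 0 := by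
    intro h
    rw [hconst w hw, h, mul_zero] at hFw
    exact hFw rfl
  refine ⟨C (eval 0 g)⁻¹ * r, fun x hx => ?_⟩
  rw [hr x hx, hconst x hx, map_mul, eval_C]
  field_simp

/-- Splitting off successively, modulo a form `F`, the equations of finitely many lines in a plane
from a polynomial vanishing at given points of these lines. -/
lemma exists_eval_eq_add_prod_mul [Infinite K] {ι : Type*} (h : n → K) (F : MvPolynomial n K)
    (L : ι → n → K) (Y : ι → Set (n → K)) (s : Finset ι)
    (hline : ∀ i ∈ s, ∀ u : MvPolynomial n K, (∀ y ∈ Y i, ∀ t : K, eval (t • y) u = 0) →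
      ∃ r : MvPolynomial n K, ∀ x, h ⬝ᵥ x = 0 → L i ⬝ᵥ x = 0 → eval x u = eval x F * eval x r)
    (hne : ∀ i ∈ s, ∀ j ∈ s, i ≠ j → ∀ y ∈ Y i, L j ⬝ᵥ y ≠ 0)
    (hhY : ∀ i ∈ s, ∀ y ∈ Y i, h ⬝ᵥ y = 0)
    (hFY : ∀ i ∈ s, ∀ y ∈ Y i, ∀ t : K, eval (t • y) F = 0)
    (u : MvPolynomial n K) (hu : ∀ i ∈ s, ∀ y ∈ Y i, ∀ t : K, eval (t • y) u = 0) :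
    ∃ r v : MvPolynomial n K, ∀ x, h ⬝ᵥ x = 0 →
      eval x u = eval x F * eval x r + (∏ i ∈ s, L i ⬝ᵥ x) * eval x v := by
  classical
  induction s using Finset.induction_on with
  | empty => exact ⟨0, u, by simp⟩
  | insert i s hi ih =>
    obtain ⟨r, v, hrv⟩ := ih (fun j hj => hline j (Finset.mem_insert_of_mem hj))
      (fun j hj j' hj' => hne j (Finset.mem_insert_of_mem hj) j' (Finset.mem_insert_of_mem hj'))
      (fun j hj => hhY j (Finset.mem_insert_of_mem hj))
      (fun j hj => hFY j (Finset.mem_insert_of_mem hj))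
      (fun j hj => hu j (Finset.mem_insert_of_mem hj))
    have his := Finset.mem_insert_self i s
    have hv : ∀ y ∈ Y i, ∀ t : K, t ≠ 0 → eval (t • y) v = 0 := by
      intro y hy t ht
      have h1 := hrv (t • y) (by rw [dotProduct_smul, hhY i his y hy, smul_zero])
      rw [hu i his y hy, hFY i his y hy, zero_mul, zero_add, eq_comm, mul_eq_zero] at h1
      refine h1.resolve_left ?_
      refine Finset.prod_ne_zero_iff.2 ?_
      intro j hj
      rw [dotProduct_smul, smul_eq_mul]
      exact mul_ne_zero ht (hne i his j (Finset.mem_insert_of_mem hj)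
        (by rintro rfl; exact hi hj) y hy)
    obtain ⟨e, he⟩ := hline i his v (by
      intro y hy t
      by_cases ht : t = 0
      · rw [ht, zero_smul, eval_zero_of_eval_smul v y 0 (hv y hy)]
      · exact hv y hy t ht)
    -- On line `i` of the plane `v` agrees with `F * e`, so in the plane the difference is a
    -- multiple of `L i`.
    obtain ⟨v', hv'⟩ := exists_eval_eq_mul (LinearMap.ker (dotProductEquiv K n h)) (L i)
      (v - F * e) (by
        intro x hx hLx
        rw [map_sub, map_mul, he x hx hLx, sub_self])
    refine ⟨r + (∏ j ∈ s, linForm (L j)) * e, v', fun x hx => ?_⟩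
    have h2 := hv' x hx
    rw [map_sub, map_mul, sub_eq_iff_eq_add] at h2
    rw [hrv x hx, h2, Finset.prod_insert hi]
    simp only [map_add, map_mul, map_prod, eval_linForm]
    ring

end LinearForms

end Geproci

namespace Geproci

open Module

/-! ### Rational points and lines, and why they form no grid -/

section RationalPoints

variable (k K : Type*) [Field k] [Field K] [Algebra k K]

/-- The extension of scalars `k ^ 4 → K ^ 4`, as a semilinear map. -/
def emb : (Fin 4 → k) →ₛₗ[algebraMap k K] (Fin 4 → K) where
  toFun v i := algebraMap k K (v i)
  map_add' v w := by ext; simp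
  map_smul' c v := by ext; simp

variable {k}

@[simp]
lemma emb_apply (v : Fin 4 → k) (i : Fin 4) : emb k K v i = algebraMap k K (v i) := rfl

lemma emb_injective : Function.Injective (emb k K) := fun v w h => by
  ext i
  exact (algebraMap k K).injective (congrFun h i)

lemma emb_ne_zero {v : Fin 4 → k} (hv : v ≠ 0) : emb k K v ≠ 0 :=
  (map_ne_zero_iff _ (emb_injective K)).2 hv

lemma emb_vecMul (v : Fin 4 → k) (A : Matrix (Fin 4) (Fin 4) k) :
    Matrix.vecMul (emb k K v) (A.map (algebraMap k K)) = emb k K (Matrix.vecMul v A) := by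
  ext i
  simp [Matrix.vecMul, dotProduct]

/-- The factor `a` is the ratio of two corresponding coordinates, hence lies in `k`. This makes
distinct `k`-points stay distinct over `K`. -/
lemma exists_smul_eq_of_smul_emb {v w : Fin 4 → k} (hw : w ≠ 0) {a : K}
    (h : a • emb k K w = emb k K v) : ∃ c : k, c • w = v := by
  obtain ⟨i, hi⟩ := Function.ne_iff.1 hw
  have hi' : algebraMap k K (w i) ≠ 0 := (map_ne_zero _).2 hi
  refine ⟨v i / w i, emb_injective K ?_⟩
  rw [LinearMap.map_smulₛₗ, ← h, map_div₀]
  have := congrFun h i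
  simp only [Pi.smul_apply, emb_apply, smul_eq_mul] at this
  rw [← this, mul_div_cancel_right₀ _ hi']

variable (k)

lemma rationalPoints_eq_range :
    rationalPoints k K = Set.range (Projectivization.map (emb k K) (emb_injective K)) := by
  ext p
  constructor
  · rintro ⟨v, hv, rfl⟩
    have hv0 : v ≠ 0 := by
      rintro rfl
      exact hv (map_zero (emb k K))
    exact ⟨Projectivization.mk k v hv0, rfl⟩
  · rintro ⟨p, rfl⟩
    induction p using Projectivization.ind with
    | h v hv => exact ⟨v, emb_ne_zero K hv, rfl⟩

variable {k}

lemma map_emb_injective :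
    Function.Injective (Projectivization.map (emb k K) (emb_injective K)) := by
  intro p p' h
  induction p using Projectivization.ind with | h v hv =>
  induction p' using Projectivization.ind with | h w hw =>
  rw [Projectivization.map_mk, Projectivization.map_mk, Projectivization.mk_eq_mk_iff'] at h
  obtain ⟨a, ha⟩ := h
  rw [Projectivization.mk_eq_mk_iff']
  exact exists_smul_eq_of_smul_emb K hw ha

lemma mk_emb_mem (v : Fin 4 → k) (hv : emb k K v ≠ 0) :
    Projectivization.mk K (emb k K v) hv ∈ rationalPoints k K := ⟨v, hv, rfl⟩

lemma liesOn_mk_iff {K : Type*} [Field K] {v : Fin 4 → K} (hv : v ≠ 0)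
    (W : Submodule K (Fin 4 → K)) : LiesOn (Projectivization.mk K v hv) W ↔ v ∈ W := by
  rw [LiesOn, Projectivization.submodule_mk, Submodule.span_singleton_le_iff_mem]

lemma liesOn_iff_rep_mem {K : Type*} [Field K] (p : P3 K) (W : Submodule K (Fin 4 → K)) :
    LiesOn p W ↔ p.rep ∈ W := by
  rw [LiesOn, Projectivization.submodule_eq, Submodule.span_singleton_le_iff_mem]

lemma eq_top_of_emb_mem (W : Submodule K (Fin 4 → K)) (h : ∀ v : Fin 4 → k, emb k K v ∈ W) :
    W = ⊤ := by
  rw [eq_top_iff]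
  intro x _
  rw [pi_eq_sum_univ x]
  refine W.sum_mem fun i _ => W.smul_mem _ ?_
  convert h (fun j => if i = j then 1 else 0)
  simp

lemma emb_mem_extend {l : Submodule k (Fin 4 → k)} {v : Fin 4 → k} (hv : v ∈ l) :
    emb k K v ∈ extend K l := Submodule.subset_span ⟨v, hv, rfl⟩

variable {K}

/-- An invertible matrix `M` with inverse `N` whose first two rows are a basis of `l`. -/
structure IsAdapted (l : Submodule k (Fin 4 → k)) (M N : Matrix (Fin 4) (Fin 4) k) : Prop where
  mul_inv : M * N = 1
  inv_mul : N * M = 1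
  mem_iff : ∀ v, v ∈ l ↔ ∃ s t : k, v = s • M 0 + t • M 1

lemma exists_isAdapted {l : Submodule k (Fin 4 → k)} (hl : IsLine l) :
    ∃ M N, IsAdapted l M N := by
  obtain ⟨m, hm⟩ := l.exists_isCompl
  have hl2 : finrank k l = 2 := hl
  have hm2 : finrank k m = 2 := by
    have := Submodule.finrank_add_eq_of_isCompl hm
    rw [hl2, finrank_fin_fun] at this
    omega
  let b := finBasisOfFinrankEq k l hl2
  let b' := finBasisOfFinrankEq k m hm2
  have hspan : Submodule.span k (Set.range (fun i => (b i : Fin 4 → k))) = l := by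
    have := congrArg (Submodule.map l.subtype) b.span_eq
    rw [Submodule.map_span, ← Set.range_comp, Submodule.map_subtype_top] at this
    exact this
  have hspan' : Submodule.span k (Set.range (fun i => (b' i : Fin 4 → k))) = m := by
    have := congrArg (Submodule.map m.subtype) b'.span_eq
    rw [Submodule.map_span, ← Set.range_comp, Submodule.map_subtype_top] at this
    exact this
  have hli := LinearIndependent.sum_type
    (b.linearIndependent.map' l.subtype l.ker_subtype)
    (b'.linearIndependent.map' m.subtype m.ker_subtype)
    (by
      have h1 : (l.subtype ∘ b) = fun i => (b i : Fin 4 → k) := rfl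
      have h2 : (m.subtype ∘ b') = fun i => (b' i : Fin 4 → k) := rfl
      rw [h1, h2, hspan, hspan']
      exact hm.disjoint)
  have hli' := hli.comp _ (finSumFinEquiv (m := 2) (n := 2)).symm.injective
  let M : Matrix (Fin 4) (Fin 4) k :=
    Matrix.of fun i => Sum.elim (l.subtype ∘ b) (m.subtype ∘ b')
      ((finSumFinEquiv (m := 2) (n := 2)).symm i)
  have hM : IsUnit M := Matrix.linearIndependent_rows_iff_isUnit.1 hli'
  have hdet := (Matrix.isUnit_iff_isUnit_det M).1 hM
  refine ⟨M, M⁻¹, Matrix.mul_nonsing_inv M hdet, Matrix.nonsing_inv_mul M hdet, fun v => ?_⟩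
  have h0 : M 0 = (b 0 : Fin 4 → k) := rfl
  have h1 : M 1 = (b 1 : Fin 4 → k) := rfl
  rw [h0, h1]
  conv_lhs => rw [← hspan]
  rw [Submodule.mem_span_range_iff_exists_fun]
  simp only [Fin.sum_univ_two]
  constructor
  · rintro ⟨c, rfl⟩
    exact ⟨c 0, c 1, rfl⟩
  · rintro ⟨s, t, rfl⟩
    exact ⟨![s, t], rfl⟩

namespace IsAdapted

variable {l : Submodule k (Fin 4 → k)} {M N : Matrix (Fin 4) (Fin 4) k} (h : IsAdapted l M N)

include h

lemma row_zero_mem : M 0 ∈ l := (h.mem_iff _).2 ⟨1, 0, by simp⟩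

lemma row_one_mem : M 1 ∈ l := (h.mem_iff _).2 ⟨0, 1, by simp⟩

lemma map_inv_mul : N.map (algebraMap k K) * M.map (algebraMap k K) = 1 := by
  rw [← Matrix.map_mul, h.inv_mul]
  simp

/-- Multiplication by `N` on the right computes coordinates in the basis of rows of `M`. -/
lemma eq_sum (x : Fin 4 → K) :
    x = ∑ i, Matrix.vecMul x (N.map (algebraMap k K)) i • emb k K (M i) := by
  conv_lhs => rw [← Matrix.vecMul_one x, ← h.map_inv_mul, ← Matrix.vecMul_vecMul]
  rw [Matrix.vecMul_eq_sum]
  rfl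

lemma vecMul_row (i j : Fin 4) :
    Matrix.vecMul (emb k K (M i)) (N.map (algebraMap k K)) j = if i = j then 1 else 0 := by
  have : Matrix.vecMul (M i) N = (1 : Matrix (Fin 4) (Fin 4) k) i := by
    rw [← h.mul_inv]
    rfl
  rw [emb_vecMul, this, emb_apply, Matrix.one_apply]
  split_ifs <;> simp

lemma mem_extend_iff (x : Fin 4 → K) : x ∈ extend K l ↔
    Matrix.vecMul x (N.map (algebraMap k K)) 2 = 0 ∧
      Matrix.vecMul x (N.map (algebraMap k K)) 3 = 0 := by
  constructor
  · intro hx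
    refine Submodule.span_induction (p := fun x _ =>
      Matrix.vecMul x (N.map (algebraMap k K)) 2 = 0 ∧
      Matrix.vecMul x (N.map (algebraMap k K)) 3 = 0) ?_ ?_ ?_ ?_ hx
    · rintro _ ⟨v, hv, rfl⟩
      obtain ⟨s, t, rfl⟩ := (h.mem_iff v).1 hv
      change Matrix.vecMul (emb k K (s • M 0 + t • M 1)) (N.map (algebraMap k K)) 2 = 0 ∧
        Matrix.vecMul (emb k K (s • M 0 + t • M 1)) (N.map (algebraMap k K)) 3 = 0
      simp only [map_add, LinearMap.map_smulₛₗ, Matrix.add_vecMul, Matrix.smul_vecMul,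
        Pi.add_apply, Pi.smul_apply, h.vecMul_row]
      simp
    · simp
    · rintro x y _ _ ⟨h1, h2⟩ ⟨h3, h4⟩
      simp [Matrix.add_vecMul, h1, h2, h3, h4]
    · rintro a x _ ⟨h1, h2⟩
      simp [Matrix.smul_vecMul, h1, h2]
  · rintro ⟨h2, h3⟩
    rw [h.eq_sum x, Fin.sum_univ_four, h2, h3, zero_smul, zero_smul, add_zero, add_zero]
    exact Submodule.add_mem _ (Submodule.smul_mem _ _ (emb_mem_extend K h.row_zero_mem))
      (Submodule.smul_mem _ _ (emb_mem_extend K h.row_one_mem))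

lemma emb_mem_extend_iff (v : Fin 4 → k) : emb k K v ∈ extend K l ↔ v ∈ l := by
  refine ⟨fun hv => ?_, emb_mem_extend K⟩
  rw [h.mem_extend_iff, emb_vecMul, emb_apply, emb_apply, map_eq_zero, map_eq_zero] at hv
  have := h.eq_sum (K := k) v
  simp only [Algebra.algebraMap_self] at this
  have hN : N.map (RingHom.id k) = N := by ext; rfl
  rw [hN, Fin.sum_univ_four, hv.1, hv.2, zero_smul, zero_smul, add_zero, add_zero] at this
  exact (h.mem_iff v).2 ⟨_, _, this⟩

lemma finrank_extend : finrank K (extend K l) = 2 := by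
  have hli : LinearIndependent K ![emb k K (M 0), emb k K (M 1)] := by
    rw [LinearIndependent.pair_iff]
    intro s t hst
    have h0 := congrArg (fun x => Matrix.vecMul x (N.map (algebraMap k K)) 0) hst
    have h1 := congrArg (fun x => Matrix.vecMul x (N.map (algebraMap k K)) 1) hst
    simp only [Matrix.add_vecMul, Matrix.smul_vecMul, Pi.add_apply, Pi.smul_apply, h.vecMul_row]
      at h0 h1
    simpa using And.intro h0 h1
  have hspan : extend K l = Submodule.span K (Set.range ![emb k K (M 0), emb k K (M 1)]) := by
    apply le_antisymm
    · intro x hx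
      rw [h.mem_extend_iff] at hx
      rw [Matrix.range_cons_cons_empty, Submodule.mem_span_pair]
      have hsum := h.eq_sum x
      rw [Fin.sum_univ_four, hx.1, hx.2, zero_smul, zero_smul, add_zero, add_zero] at hsum
      exact ⟨_, _, hsum.symm⟩
    · rw [Submodule.span_le, Matrix.range_cons_cons_empty]
      rintro x (rfl | rfl)
      exacts [emb_mem_extend K h.row_zero_mem, emb_mem_extend K h.row_one_mem]
  rw [hspan, finrank_span_eq_card hli, Fintype.card_fin]

end IsAdapted

variable (K)

lemma isLine_extend {l : Submodule k (Fin 4 → k)} (hl : IsLine l) : IsLine (extend K l) := by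
  obtain ⟨M, N, h⟩ := exists_isAdapted hl
  exact h.finrank_extend

lemma emb_mem_extend_iff {l : Submodule k (Fin 4 → k)} (hl : IsLine l) (v : Fin 4 → k) :
    emb k K v ∈ extend K l ↔ v ∈ l := by
  obtain ⟨M, N, h⟩ := exists_isAdapted hl
  exact h.emb_mem_extend_iff v

lemma extend_injOn {l l' : Submodule k (Fin 4 → k)} (hl : IsLine l) (hl' : IsLine l')
    (h : extend K l = extend K l') : l = l' := by
  ext v
  rw [← emb_mem_extend_iff K hl, h, emb_mem_extend_iff K hl']

/-- Disjoint lines of `k ^ 4` span it, so their extensions span `K ^ 4`; the dimension formula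
leaves no room for an intersection. -/
lemma disjoint_extend {l l' : Submodule k (Fin 4 → k)} (hl : IsLine l) (hl' : IsLine l')
    (h : Disjoint l l') : Disjoint (extend K l) (extend K l') := by
  have h1 := Submodule.finrank_sup_add_finrank_inf_eq l l'
  rw [h.eq_bot, finrank_bot, add_zero, show finrank k l = 2 from hl,
    show finrank k l' = 2 from hl'] at h1
  have htop : l ⊔ l' = ⊤ := Submodule.eq_top_of_finrank_eq (by rw [h1, finrank_fin_fun])
  have htop' : extend K l ⊔ extend K l' = ⊤ := by
    refine eq_top_of_emb_mem (k := k) K _ fun v => ?_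
    obtain ⟨a, ha, b, hb, rfl⟩ := Submodule.mem_sup.1 (htop ▸ Submodule.mem_top : v ∈ l ⊔ l')
    rw [map_add]
    exact Submodule.add_mem_sup (emb_mem_extend K ha) (emb_mem_extend K hb)
  have h2 := Submodule.finrank_sup_add_finrank_inf_eq (extend K l) (extend K l')
  rw [htop', finrank_top, finrank_fin_fun, show finrank K (extend K l) = 2 from isLine_extend K hl,
    show finrank K (extend K l') = 2 from isLine_extend K hl'] at h2
  rw [disjoint_iff]
  exact Submodule.finrank_eq_zero.1 (by omega)

lemma finite_rationalPoints [Finite k] : (rationalPoints k K).Finite := by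
  rw [rationalPoints_eq_range]
  exact Set.finite_range _

lemma ncard_rationalPoints [Finite k] :
    (rationalPoints k K).ncard = (Nat.card k + 1) * (Nat.card k ^ 2 + 1) := by
  rw [rationalPoints_eq_range, ← Set.image_univ,
    Set.ncard_image_of_injective _ (map_emb_injective K), Set.ncard_univ,
    Projectivization.card_of_finrank k _ (finrank_fin_fun k)]
  simp only [Finset.sum_range_succ, Finset.sum_range_zero]
  ring

lemma ncard_liesOn [Finite k] {l : Submodule k (Fin 4 → k)} (hl : IsLine l) :
    {p : P3 k | LiesOn p l}.ncard = Nat.card k + 1 := by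
  have : {p : P3 k | LiesOn p l} =
      Set.range (Projectivization.map l.subtype l.injective_subtype) := by
    ext p
    induction p using Projectivization.ind with | h v hv =>
    rw [Set.mem_ofPred_eq, liesOn_mk_iff]
    constructor
    · intro hvl
      exact ⟨Projectivization.mk k ⟨v, hvl⟩ (fun h => hv (congrArg Subtype.val h)), rfl⟩
    · rintro ⟨p, hp⟩
      induction p using Projectivization.ind with | h w hw =>
      rw [Projectivization.map_mk, Projectivization.mk_eq_mk_iff'] at hp
      obtain ⟨a, ha⟩ := hp
      have h1 : a • v ∈ l := by
        rw [ha]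
        exact w.2
      have ha0 : a ≠ 0 := by
        rintro rfl
        rw [zero_smul] at ha
        exact hw (Subtype.ext ha.symm)
      exact (l.smul_mem_iff ha0).1 h1
  rw [this, ← Set.image_univ,
    Set.ncard_image_of_injective _ (Projectivization.map_injective _ l.injective_subtype),
    Set.ncard_univ, Projectivization.card_of_finrank_two k l hl]

lemma ncard_rationalPoints_liesOn_extend [Finite k] {l : Submodule k (Fin 4 → k)}
    (hl : IsLine l) :
    {p | p ∈ rationalPoints k K ∧ LiesOn p (extend K l)}.ncard = Nat.card k + 1 := by
  rw [← ncard_liesOn hl,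
    ← Set.ncard_image_of_injective {p : P3 k | LiesOn p l} (map_emb_injective K)]
  refine congrArg Set.ncard (Set.ext fun p => ?_)
  rw [rationalPoints_eq_range]
  constructor
  · rintro ⟨⟨p, rfl⟩, hp⟩
    refine ⟨p, ?_, rfl⟩
    induction p using Projectivization.ind with | h v hv =>
    rw [Projectivization.map_mk, liesOn_mk_iff, emb_mem_extend_iff K hl] at hp
    rwa [Set.mem_ofPred_eq, liesOn_mk_iff]
  · rintro ⟨p, hp, rfl⟩
    refine ⟨⟨p, rfl⟩, ?_⟩
    induction p using Projectivization.ind with | h v hv =>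
    rw [Set.mem_ofPred_eq, liesOn_mk_iff] at hp
    rwa [Projectivization.map_mk, liesOn_mk_iff, emb_mem_extend_iff K hl]

/-- A line through two rational points is defined over the base field. -/
lemma exists_eq_extend {m : Submodule K (Fin 4 → K)} (hm : IsLine m) {p p' : P3 K}
    (hp : p ∈ rationalPoints k K) (hp' : p' ∈ rationalPoints k K) (hne : p ≠ p')
    (hpm : LiesOn p m) (hpm' : LiesOn p' m) :
    ∃ l : Submodule k (Fin 4 → k), IsLine l ∧ m = extend K l := by
  obtain ⟨v, hv, rfl⟩ := hp
  obtain ⟨w, hw, rfl⟩ := hp'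
  change emb k K v ≠ 0 at hv
  change emb k K w ≠ 0 at hw
  have hv0 : v ≠ 0 := by rintro rfl; exact hv (map_zero _)
  have hli : LinearIndependent k ![v, w] := by
    rw [LinearIndependent.pair_iff' hv0]
    intro a ha
    apply hne.symm
    refine (Projectivization.mk_eq_mk_iff' K _ _ hw hv).2 ⟨algebraMap k K a, ?_⟩
    change algebraMap k K a • emb k K v = emb k K w
    rw [← ha, LinearMap.map_smulₛₗ]
  have hl : IsLine (Submodule.span k (Set.range ![v, w])) := by
    rw [IsLine, finrank_span_eq_card hli, Fintype.card_fin]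
  refine ⟨_, hl, (Submodule.eq_of_le_of_finrank_eq ?_ ((isLine_extend K hl).trans hm.symm)).symm⟩
  refine Submodule.span_le.2 ?_
  rintro _ ⟨u, hu, rfl⟩
  rw [SetLike.mem_coe, Matrix.range_cons_cons_empty, Submodule.mem_span_pair] at hu
  obtain ⟨a, b, rfl⟩ := hu
  change emb k K (a • v + b • w) ∈ m
  rw [map_add, LinearMap.map_smulₛₗ, LinearMap.map_smulₛₗ]
  exact m.add_mem (m.smul_mem _ ((liesOn_mk_iff hv m).1 hpm))
    (m.smul_mem _ ((liesOn_mk_iff hw m).1 hpm'))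

variable (k)

lemma not_forall_liesOn (W : Submodule K (Fin 4 → K)) (hW : finrank K W ≤ 3) :
    ¬ ∀ p ∈ rationalPoints k K, LiesOn p W := by
  intro h
  have : W = ⊤ := by
    refine eq_top_of_emb_mem (k := k) K W fun v => ?_
    by_cases hv : v = 0
    · rw [hv, map_zero]
      exact W.zero_mem
    · exact (liesOn_mk_iff (emb_ne_zero K hv) W).1 (h _ (mk_emb_mem K v _))
  rw [this, finrank_top, finrank_fin_fun] at hW
  omega

/-- Each line of the first family of a grid contains as many points of the grid as there are lines
in the second family. -/
lemma ncard_grid_line {K : Type*} [Field K] {A B : Finset (Submodule K (Fin 4 → K))}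
    (hB : ∀ m ∈ B, ∀ m' ∈ B, m ≠ m' → Disjoint m m')
    (hAB : ∀ l ∈ A, ∀ m ∈ B, finrank K (l ⊓ m : Submodule K (Fin 4 → K)) = 1)
    {l : Submodule K (Fin 4 → K)} (hl : l ∈ A) :
    {p : P3 K | p ∈ {p | ∃ l ∈ A, ∃ m ∈ B, LiesOn p l ∧ LiesOn p m} ∧ LiesOn p l}.ncard =
      B.card := by
  have hdisj : ∀ {m m' : Submodule K (Fin 4 → K)} {p : P3 K}, LiesOn p m → LiesOn p m' →
      ¬ Disjoint m m' := fun {m m' p} h h' hd =>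
    p.rep_nonzero (Submodule.disjoint_def.1 hd _ ((liesOn_iff_rep_mem p m).1 h)
      ((liesOn_iff_rep_mem p m').1 h'))
  have hlie : ∀ {m : Submodule K (Fin 4 → K)} (hm : m ∈ B),
      LiesOn (Projectivization.mk'' (l ⊓ m) (hAB l hl m hm)) l ∧
      LiesOn (Projectivization.mk'' (l ⊓ m) (hAB l hl m hm)) m := by
    intro m hm
    simp only [LiesOn, Projectivization.submodule_mk'']
    exact ⟨inf_le_left, inf_le_right⟩
  rw [← Set.ncard_coe_finset B]
  symm
  refine Set.ncard_congr (fun m hm => Projectivization.mk'' (l ⊓ m) (hAB l hl m hm)) ?_ ?_ ?_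
  · intro m hm
    exact ⟨⟨l, hl, m, hm, hlie hm⟩, (hlie hm).1⟩
  · intro m m' hm hm' h
    by_contra hne
    refine hdisj (hlie hm).2 (m' := m') ?_ (hB m hm m' hm' hne)
    rw [h]
    exact (hlie hm').2
  · rintro p ⟨⟨l', hl', m, hm, hpl', hpm⟩, hpl⟩
    refine ⟨m, hm, Projectivization.submodule_injective ?_⟩
    rw [Projectivization.submodule_mk'']
    refine (Submodule.eq_of_le_of_finrank_eq (le_inf hpl hpm) ?_).symm
    rw [hAB l hl m hm, Projectivization.finrank_submodule]

/-- Two rational points force the line to be defined over `k`. -/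
lemma card_eq_of_ncard_liesOn [Finite k] {m : Submodule K (Fin 4 → K)} (hm : IsLine m)
    (h : 2 ≤ {p | p ∈ rationalPoints k K ∧ LiesOn p m}.ncard) :
    {p | p ∈ rationalPoints k K ∧ LiesOn p m}.ncard = Nat.card k + 1 := by
  obtain ⟨p, ⟨hp, hpm⟩, p', ⟨hp', hpm'⟩, hne⟩ := (Set.one_lt_ncard
    ((finite_rationalPoints K).subset fun _ h => h.1)).1 h
  obtain ⟨l, hl, rfl⟩ := exists_eq_extend K hm hp hp' hne hpm hpm'
  exact ncard_rationalPoints_liesOn_extend K hl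

/-- Rational points span `K ^ 4`, so they are not coplanar. In a grid both families would have `q +
1` members, too few to account for `(q + 1) * (q ^ 2 + 1)` points. -/
lemma isNontrivial_rationalPoints [Finite k] : IsNontrivial (rationalPoints k K) := by
  refine ⟨fun ⟨W, hW, h⟩ => not_forall_liesOn k K W hW.le h, ?_⟩
  rintro a b ⟨A, B, -, -, hAl, hBl, hA, hB, hAB, hZ⟩
  have hnA : ∀ l ∈ A, {p | p ∈ rationalPoints k K ∧ LiesOn p l}.ncard = B.card := by
    intro l hl
    rw [hZ]
    exact ncard_grid_line hB hAB hl
  have hnB : ∀ m ∈ B, {p | p ∈ rationalPoints k K ∧ LiesOn p m}.ncard = A.card := by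
    intro m hm
    rw [hZ, ← ncard_grid_line hA (fun m hm l hl => inf_comm l m ▸ hAB l hl m hm) hm]
    refine congrArg Set.ncard (Set.ext fun p => ?_)
    constructor
    · rintro ⟨⟨l, hl, m, hm, h1, h2⟩, h⟩
      exact ⟨⟨m, hm, l, hl, h2, h1⟩, h⟩
    · rintro ⟨⟨l, hl, m, hm, h1, h2⟩, h⟩
      exact ⟨⟨m, hm, l, hl, h2, h1⟩, h⟩
  -- Each family has at least two lines, so each line of the other family carries at least two
  -- rational points, as `card_eq_of_ncard_liesOn` requires.
  have two_le : ∀ A : Finset (Submodule K (Fin 4 → K)), (∀ l ∈ A, IsLine l) →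
      (∀ p ∈ rationalPoints k K, ∃ l ∈ A, LiesOn p l) → 2 ≤ A.card := by
    intro A hAl hcov
    by_contra! hcard
    have hle : A.card ≤ 1 := by omega
    rw [Finset.card_le_one_iff_subset_singleton] at hle
    obtain ⟨l, hAl'⟩ := hle
    by_cases hlA : l ∈ A
    · refine not_forall_liesOn k K l ?_ fun p hp => ?_
      · rw [show finrank K l = 2 from hAl l hlA]
        omega
      · obtain ⟨l', hl', hp'⟩ := hcov p hp
        rwa [← Finset.mem_singleton.1 (hAl' hl')]
    · refine not_forall_liesOn k K ⊥ (by simp) fun p hp => ?_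
      obtain ⟨l', hl', hp'⟩ := hcov p hp
      exact absurd (Finset.mem_singleton.1 (hAl' hl') ▸ hl') hlA
  have hcovA : ∀ p ∈ rationalPoints k K, ∃ l ∈ A, LiesOn p l := by
    rw [hZ]
    rintro p ⟨l, hl, m, hm, h1, h2⟩
    exact ⟨l, hl, h1⟩
  have hcovB : ∀ p ∈ rationalPoints k K, ∃ m ∈ B, LiesOn p m := by
    rw [hZ]
    rintro p ⟨l, hl, m, hm, h1, h2⟩
    exact ⟨m, hm, h2⟩
  have hA2 := two_le A hAl hcovA
  have hB2 := two_le B hBl hcovB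
  obtain ⟨l, hl⟩ := Finset.card_pos.1 (by omega : 0 < A.card)
  obtain ⟨m, hm⟩ := Finset.card_pos.1 (by omega : 0 < B.card)
  have hBq : B.card = Nat.card k + 1 := by
    rw [← hnA l hl]
    exact card_eq_of_ncard_liesOn k K (hAl l hl) (by rw [hnA l hl]; exact hB2)
  have hAq : A.card = Nat.card k + 1 := by
    rw [← hnB m hm]
    exact card_eq_of_ncard_liesOn k K (hBl m hm) (by rw [hnB m hm]; exact hA2)
  have hle : (rationalPoints k K).ncard ≤ A.card * B.card := by
    have hU : rationalPoints k K = ⋃ l ∈ A, {p | p ∈ rationalPoints k K ∧ LiesOn p l} := by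
      ext p
      simp only [Set.mem_iUnion, Set.mem_ofPred_eq, exists_prop]
      constructor
      · intro hp
        obtain ⟨l, hl, h⟩ := hcovA p hp
        exact ⟨l, hl, hp, h⟩
      · rintro ⟨l, hl, hp, h⟩
        exact hp
    calc (rationalPoints k K).ncard
        = (⋃ l ∈ A, {p | p ∈ rationalPoints k K ∧ LiesOn p l}).ncard := by rw [← hU]
      _ ≤ ∑ l ∈ A, {p | p ∈ rationalPoints k K ∧ LiesOn p l}.ncard :=
        Finset.set_ncard_biUnion_le _ _
      _ = A.card * B.card := by rw [Finset.sum_congr rfl hnA, Finset.sum_const, smul_eq_mul]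
  rw [ncard_rationalPoints, hAq, hBq] at hle
  have h1 := Nat.le_of_mul_le_mul_left hle (Nat.succ_pos _)
  have h2 : 1 < Nat.card k := Finite.one_lt_card
  nlinarith

end RationalPoints

/-! ### Spreads: cardinality and existence -/

section Spreads

variable {k : Type*} [Field k]

lemma IsSpread.existsUnique {S : Set (Submodule k (Fin 4 → k))} (hS : IsSpread S)
    {v : Fin 4 → k} (hv : v ≠ 0) : ∃! l, l ∈ S ∧ v ∈ l := by
  simpa only [liesOn_mk_iff] using hS.2 (Projectivization.mk k v hv)

lemma IsSpread.disjoint {S : Set (Submodule k (Fin 4 → k))} (hS : IsSpread S)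
    {l l' : Submodule k (Fin 4 → k)} (hl : l ∈ S) (hl' : l' ∈ S) (hne : l ≠ l') :
    Disjoint l l' := by
  rw [Submodule.disjoint_def]
  intro v hv hv'
  by_contra hv0
  exact hne ((hS.existsUnique hv0).unique ⟨hl, hv⟩ ⟨hl', hv'⟩)

/-- The lines of `S` partition the nonzero vectors, so `q ^ 4 - 1 = |S| * (q ^ 2 - 1)`. -/
lemma IsSpread.ncard [Finite k] {S : Set (Submodule k (Fin 4 → k))} (hS : IsSpread S) :
    S.ncard = Nat.card k ^ 2 + 1 := by
  classical
  have := Fintype.ofFinite k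
  let f : {v : Fin 4 → k // v ≠ 0} → S := fun v =>
    ⟨(hS.existsUnique v.2).exists.choose, (hS.existsUnique v.2).exists.choose_spec.1⟩
  have hf : ∀ v, v.1 ∈ (f v).1 := fun v => (hS.existsUnique v.2).exists.choose_spec.2
  let e : ∀ l : S, {v : {v : Fin 4 → k // v ≠ 0} // f v = l} ≃ {v : l.1 // v ≠ 0} := fun l =>
    { toFun := fun v => ⟨⟨v.1.1, by have := hf v.1; rwa [v.2] at this⟩,
        fun h => v.1.2 (congrArg Subtype.val h)⟩
      invFun := fun v => ⟨⟨v.1.1, fun h => v.2 (Subtype.ext h)⟩, Subtype.ext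
        ((hS.existsUnique (fun h => v.2 (Subtype.ext h))).unique ⟨(f _).2, hf _⟩ ⟨l.2, v.1.2⟩)⟩
      left_inv := fun v => rfl
      right_inv := fun v => rfl }
  have hcard : ∀ (V : Type _) [AddCommGroup V] [Finite V],
      Nat.card {v : V // v ≠ 0} = Nat.card V - 1 := by
    intro V _ _
    have := Fintype.ofFinite V
    rw [Nat.card_eq_fintype_card, Nat.card_eq_fintype_card, Fintype.card_subtype_compl,
      Fintype.card_subtype_eq]
  have h1 := Nat.card_congr ((Equiv.sigmaCongrRight e).symm.trans (Equiv.sigmaFiberEquiv f))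
  rw [Nat.card_sigma, hcard (Fin 4 → k), Module.natCard_eq_pow_finrank (K := k),
    finrank_fin_fun] at h1
  have h2 : ∀ l : S, Nat.card {v : l.1 // v ≠ 0} = Nat.card k ^ 2 - 1 := by
    intro l
    rw [hcard, Module.natCard_eq_pow_finrank (K := k), show finrank k l.1 = 2 from hS.1 l l.2]
  simp only [h2, Finset.sum_const, Finset.card_univ, smul_eq_mul] at h1
  rw [← Nat.card_coe_set_eq, Nat.card_eq_fintype_card]
  have hq : 1 < Nat.card k := Finite.one_lt_card
  have hq2 : 1 < Nat.card k ^ 2 := Nat.one_lt_pow (by norm_num) hq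
  have h3 : Nat.card k ^ 4 - 1 = (Nat.card k ^ 2 + 1) * (Nat.card k ^ 2 - 1) := by
    have := Nat.sq_sub_sq (Nat.card k ^ 2) 1
    rwa [← pow_mul, one_pow] at this
  rw [h3] at h1
  exact Nat.eq_of_mul_eq_mul_right (by omega) h1

variable (k) in
/-- The lines of `k ^ 4` underlying the points of the projective line over a quadratic extension
form a spread. -/
lemma exists_isSpread [Finite k] : ∃ S : Set (Submodule k (Fin 4 → k)), IsSpread S := by
  obtain ⟨p, hp⟩ := CharP.exists k
  have hprime : Fact p.Prime := ⟨CharP.char_is_prime k p⟩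
  let L := FiniteField.Extension k p 2
  have hL : finrank k L = 2 := FiniteField.finrank_extension k p 2
  have hV : finrank k (Fin 2 → L) = finrank k (Fin 4 → k) := by
    rw [finrank_fin_fun, finrank_pi_fintype, Fin.sum_univ_two, hL]
  -- Any `k`-linear identification will do: one-dimensional `L`-subspaces have dimension two over
  -- `k` and partition the nonzero vectors.
  let e : (Fin 2 → L) ≃ₗ[k] (Fin 4 → k) := LinearEquiv.ofFinrankEq _ _ hV
  let line : (Fin 2 → L) → Submodule k (Fin 4 → k) := fun v =>
    ((Submodule.span L {v}).restrictScalars k).map e.toLinearMap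
  have hline : ∀ v x, x ∈ line v ↔ ∃ a : L, a • v = e.symm x := by
    intro v x
    simp only [line, Submodule.mem_map, Submodule.restrictScalars_mem,
      Submodule.mem_span_singleton]
    constructor
    · rintro ⟨_, ⟨a, rfl⟩, rfl⟩
      exact ⟨a, by simp⟩
    · rintro ⟨a, ha⟩
      exact ⟨a • v, ⟨a, rfl⟩, by rw [ha]; simp⟩
  refine ⟨{l | ∃ v, v ≠ 0 ∧ l = line v}, ?_, ?_⟩
  · rintro _ ⟨v, hv, rfl⟩
    have h1 : finrank k (line v) = finrank k (Submodule.span L {v}) :=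
      LinearEquiv.finrank_map_eq e ((Submodule.span L {v}).restrictScalars k)
    rw [IsLine, h1, ← finrank_mul_finrank k L, hL, finrank_span_singleton hv]
  · intro P
    induction P using Projectivization.ind with | h x hx =>
    simp only [liesOn_mk_iff]
    have hx' : e.symm x ≠ 0 := (map_ne_zero_iff _ e.symm.injective).2 hx
    refine ⟨line (e.symm x), ⟨⟨_, hx', rfl⟩, (hline _ _).2 ⟨1, one_smul _ _⟩⟩, ?_⟩
    rintro _ ⟨⟨v, hv, rfl⟩, hxv⟩
    obtain ⟨a, ha⟩ := (hline _ _).1 hxv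
    have ha0 : a ≠ 0 := by
      rintro rfl
      exact hx' (by rw [← ha, zero_smul])
    ext y
    rw [hline, hline, ← ha]
    constructor
    · rintro ⟨b, hb⟩
      exact ⟨b * a⁻¹, by rw [smul_smul, mul_assoc, inv_mul_cancel₀ ha0, mul_one, hb]⟩
    · rintro ⟨b, hb⟩
      exact ⟨b * a, by rw [← hb, smul_smul]⟩

end Spreads

end Geproci

namespace Geproci

open Module MvPolynomial

/-! ### The Frobenius map relative to `k` -/

section Frobenius

variable (k : Type*) {K : Type*} [Field k] [Finite k] [Field K] [Algebra k K]

/-- The Frobenius endomorphism of `K` relative to the finite field `k`. -/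
noncomputable def frob : K →ₐ[k] K :=
  letI := Fintype.ofFinite k
  FiniteField.frobeniusAlgHom k K

lemma frob_apply (x : K) : frob k x = x ^ Nat.card k := by
  let := Fintype.ofFinite k
  rw [Nat.card_eq_fintype_card]
  rfl

/-- `X ^ q - X` splits over `k` as the product of all `X - c`, so its roots in `K` come from `k`. -/
lemma mem_range_of_pow_card_eq {x : K} (hx : x ^ Nat.card k = x) :
    ∃ c : k, algebraMap k K c = x := by
  let := Fintype.ofFinite k
  have hq : 1 < Fintype.card k := Fintype.one_lt_card
  have hprod := Polynomial.prod_multiset_X_sub_C_of_monic_of_roots_card_eq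
    (p := (Polynomial.X ^ Fintype.card k - Polynomial.X : Polynomial k))
    (Polynomial.monic_X_pow_sub (by rw [Polynomial.degree_X]; exact_mod_cast hq))
    (by rw [FiniteField.roots_X_pow_card_sub_X, FiniteField.X_pow_card_sub_X_natDegree_eq k hq]; rfl)
  rw [FiniteField.roots_X_pow_card_sub_X] at hprod
  have h : ∏ c : k, (x - algebraMap k K c) = 0 := by
    have h1 := congrArg (Polynomial.aeval x)
      (show ∏ c : k, (Polynomial.X - Polynomial.C c) = _ from hprod)
    simpa [← Nat.card_eq_fintype_card, hx] using h1
  obtain ⟨c, -, hc⟩ := Finset.prod_eq_zero_iff.1 h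
  exact ⟨c, (sub_eq_zero.1 hc).symm⟩

end Frobenius

/-! ### The Moore determinant -/

section MooreForm

variable {K : Type*} [Field K]

lemma eval_mooreForm (q : ℕ) (p x : Fin 4 → K) : eval x (mooreForm q p) =
    Matrix.det (Matrix.of ![p, fun i => p i ^ q, x, fun i => x i ^ q]) := by
  rw [mooreForm, RingHom.map_det]
  congr 1
  ext i j
  fin_cases i <;> simp

lemma isHomogeneous_mooreForm (q : ℕ) (p : Fin 4 → K) :
    (mooreForm q p).IsHomogeneous (q + 1) := by
  rw [mooreForm, Matrix.det_apply]
  refine IsHomogeneous.sum _ _ _ fun σ _ => ?_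
  -- The entries of row `j` have degree `![0, 0, 1, q] j`, and each permutation uses every row once.
  have hdeg : q + 1 = ∑ i, (![0, 0, 1, q] : Fin 4 → ℕ) (σ i) := by
    rw [Equiv.sum_comp σ (![0, 0, 1, q] : Fin 4 → ℕ), Fin.sum_univ_four]
    simp [add_comm]
  rw [Units.smul_def, zsmul_eq_mul, ← map_intCast (C (σ := Fin 4) (R := K))]
  refine IsHomogeneous.C_mul ?_ _
  rw [hdeg]
  refine IsHomogeneous.prod _ _ _ fun i _ => ?_
  generalize σ i = j
  fin_cases j
  · exact isHomogeneous_C _ _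
  · exact isHomogeneous_C _ _
  · exact isHomogeneous_X _ _
  · exact isHomogeneous_X_pow _ _

variable (k : Type*) [Field k] [Finite k] [Algebra k K]

/-- By additivity of Frobenius, the translation adds to the last two rows multiples of the first
two. -/
lemma eval_add_smul_mooreForm (p x : Fin 4 → K) (a : K) :
    eval (x + a • p) (mooreForm (Nat.card k) p) = eval x (mooreForm (Nat.card k) p) := by
  have hpow : ∀ i, (x i + a * p i) ^ Nat.card k =
      x i ^ Nat.card k + a ^ Nat.card k * p i ^ Nat.card k := by
    intro i
    rw [← frob_apply, map_add, map_mul]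
    simp only [frob_apply]
  rw [eval_mooreForm, eval_mooreForm]
  simp only [Pi.add_apply, Pi.smul_apply, smul_eq_mul, hpow]
  simp [Matrix.det_succ_row_zero, Fin.sum_univ_succ, Fin.succAbove]
  ring

variable {k}

lemma eval_emb_mooreForm (p : Fin 4 → K) (v : Fin 4 → k) :
    eval (emb k K v) (mooreForm (Nat.card k) p) = 0 := by
  rw [eval_mooreForm]
  refine Matrix.det_zero_of_row_eq (i := 2) (j := 3) (by decide) ?_
  ext i
  simp [← frob_apply k]

end MooreForm

/-! ### Generic vertices and projection from them -/

section Generic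

variable (k : Type*) {K : Type*} [Field k] [Field K] [Algebra k K]

/-- No nonzero linear form over `k` vanishes at the vector `p`. -/
def IsGeneric (p : Fin 4 → K) : Prop := ∀ c : Fin 4 → k, emb k K c ⬝ᵥ p = 0 → c = 0

lemma vanishesAt_mk_iff {f : CoordRing K} {d : ℕ} (hf : f.IsHomogeneous d) {v : Fin 4 → K}
    (hv : v ≠ 0) : VanishesAt f (Projectivization.mk K v hv) ↔ eval v f = 0 := by
  obtain ⟨a, ha⟩ := Projectivization.exists_smul_eq_mk_rep K v hv
  rw [VanishesAt, ← ha, Units.smul_def, eval_smul_of_isHomogeneous hf, mul_eq_zero]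
  simp

/-- The closed set to avoid is the zero locus of the product of the equations of all rational
planes, a nonzero form because `k` is finite. -/
lemma forGeneralPoint_of_isGeneric [Finite k] [Infinite K] {prop : P3 K → Prop}
    (h : ∀ P : P3 K, IsGeneric k P.rep → prop P) : ForGeneralPoint prop := by
  classical
  have := Fintype.ofFinite k
  let s : Finset (Fin 4 → k) := Finset.univ.filter (· ≠ 0)
  let f : CoordRing K := ∏ c ∈ s, linForm (emb k K c)
  have hf : f.IsHomogeneous (∑ c ∈ s, 1) :=
    IsHomogeneous.prod _ _ _ fun c _ => isHomogeneous_linForm _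
  refine ⟨{P | ∀ g ∈ ({f} : Set (CoordRing K)), VanishesAt g P}, ⟨{f}, ?_, rfl⟩, ?_, ?_⟩
  · rintro _ rfl
    exact ⟨_, hf⟩
  · intro huniv
    have hf0 : f = 0 := by
      refine MvPolynomial.funext fun x => ?_
      rw [map_zero]
      by_cases hx : x = 0
      · rw [hx, map_prod]
        -- The origin is not a projective point, so it is treated apart: any factor vanishes there,
        -- for instance that of the all-ones vector.
        refine Finset.prod_eq_zero (i := 1) (by simp [s]) ?_
        rw [eval_linForm, dotProduct_zero]
      · have hm : Projectivization.mk K x hx ∈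
            {P : P3 K | ∀ g ∈ ({f} : Set (CoordRing K)), VanishesAt g P} :=
          huniv ▸ Set.mem_univ _
        exact (vanishesAt_mk_iff hf hx).1 (hm f rfl)
    obtain ⟨c, hc, hc0⟩ := Finset.prod_eq_zero_iff.1 hf0
    obtain ⟨i, hi⟩ := Function.ne_iff.1 (Finset.mem_filter.1 hc).2
    have := congrArg (eval (Pi.single i 1)) hc0
    rw [eval_linForm, map_zero, dotProduct_single, mul_one, emb_apply, map_eq_zero] at this
    exact hi this
  · intro P hP
    refine h P fun c hc => ?_
    by_contra hc0
    apply hP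
    rintro _ rfl
    rw [VanishesAt, map_prod]
    exact Finset.prod_eq_zero (i := c) (by simp [s, hc0]) (by rw [eval_linForm, hc])

variable {k}

/-- Genericity is preserved by coordinate changes over `k`, so adapted coordinates may be used. -/
lemma IsGeneric.emb_dotProduct_vecMul {p : Fin 4 → K} (hp : IsGeneric k p)
    {M N : Matrix (Fin 4) (Fin 4) k} (hMN : M * N = 1) (c : Fin 4 → k)
    (hc : emb k K c ⬝ᵥ Matrix.vecMul p (N.map (algebraMap k K)) = 0) : c = 0 := by
  have h1 : emb k K (Matrix.mulVec N c) ⬝ᵥ p = 0 := by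
    rw [← hc, dotProduct_comm (emb k K c), ← Matrix.dotProduct_mulVec, dotProduct_comm]
    congr 1
    ext i
    simp [Matrix.mulVec, dotProduct]
  have h2 := hp _ h1
  have h3 := congrArg (Matrix.mulVec M) h2
  rwa [Matrix.mulVec_mulVec, hMN, Matrix.one_mulVec, Matrix.mulVec_zero] at h3

lemma IsGeneric.pair_eq_zero {p : Fin 4 → K} (hp : IsGeneric k p)
    {M N : Matrix (Fin 4) (Fin 4) k} (hMN : M * N = 1) (s t : k)
    (h : algebraMap k K s * Matrix.vecMul p (N.map (algebraMap k K)) 2 +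
      algebraMap k K t * Matrix.vecMul p (N.map (algebraMap k K)) 3 = 0) : s = 0 ∧ t = 0 := by
  have := hp.emb_dotProduct_vecMul hMN ![0, 0, s, t] (by
    rw [← h]
    simp [dotProduct, Fin.sum_univ_four])
  exact ⟨congrFun this 2, congrFun this 3⟩

/-- The equation of the plane spanned by a generic point and a rational line. -/
lemma IsGeneric.exists_plane {p : Fin 4 → K} (hp : IsGeneric k p)
    {l : Submodule k (Fin 4 → k)} (hl : IsLine l) :
    ∃ L : Fin 4 → K, (∀ x, L ⬝ᵥ x = 0 ↔ x ∈ Submodule.span K {p} ⊔ extend K l) ∧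
      ∀ v : Fin 4 → k, L ⬝ᵥ emb k K v = 0 → v ∈ l := by
  obtain ⟨M, N, h⟩ := exists_isAdapted hl
  set p' := Matrix.vecMul p (N.map (algebraMap k K)) with hp'
  -- In adapted coordinates `y` the line is `y 2 = y 3 = 0`, and `p' 3 * y 2 - p' 2 * y 3` is the
  -- pencil member through `p'`. At a rational vector its vanishing is a `k`-linear relation between
  -- `p' 2` and `p' 3`, which genericity makes trivial.
  let L : Fin 4 → K := fun j => p' 3 * algebraMap k K (N j 2) - p' 2 * algebraMap k K (N j 3)
  have hL : ∀ x, L ⬝ᵥ x = p' 3 * Matrix.vecMul x (N.map (algebraMap k K)) 2 -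
      p' 2 * Matrix.vecMul x (N.map (algebraMap k K)) 3 := by
    intro x
    simp only [L, Matrix.vecMul, dotProduct, Matrix.map_apply, Fin.sum_univ_four]
    ring
  have h2 : p' 2 ≠ 0 := by
    intro h2
    have := hp.pair_eq_zero h.mul_inv 1 0 (by simp [← hp', h2])
    exact one_ne_zero this.1
  refine ⟨L, fun x => ?_, fun v hv => ?_⟩
  · rw [hL, Submodule.mem_sup]
    constructor
    · intro hx
      refine ⟨(Matrix.vecMul x (N.map (algebraMap k K)) 2 / p' 2) • p,
        Submodule.smul_mem _ _ (Submodule.mem_span_singleton_self p),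
        x - (Matrix.vecMul x (N.map (algebraMap k K)) 2 / p' 2) • p, ?_, by abel⟩
      rw [h.mem_extend_iff, Matrix.sub_vecMul, Matrix.smul_vecMul, ← hp']
      simp only [Pi.sub_apply, Pi.smul_apply, smul_eq_mul]
      refine ⟨by field_simp; ring, ?_⟩
      field_simp
      linear_combination -hx
    · rintro ⟨y, hy, z, hz, rfl⟩
      obtain ⟨a, rfl⟩ := Submodule.mem_span_singleton.1 hy
      rw [h.mem_extend_iff] at hz
      rw [Matrix.add_vecMul, Matrix.smul_vecMul, ← hp']
      simp only [Pi.add_apply, Pi.smul_apply, smul_eq_mul, hz.1, hz.2]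
      ring
  · rw [hL, emb_vecMul, emb_apply, emb_apply] at hv
    obtain ⟨h3, h2⟩ := hp.pair_eq_zero h.mul_inv (-Matrix.vecMul v N 3) (Matrix.vecMul v N 2) (by
      rw [map_neg, ← hv]
      ring)
    rw [← h.emb_mem_extend_iff (K := K), h.mem_extend_iff, emb_vecMul, emb_apply, emb_apply, h2,
      neg_eq_zero.1 h3, map_zero]
    exact ⟨rfl, rfl⟩

lemma IsGeneric.notMem_extend {p : Fin 4 → K} (hp : IsGeneric k p)
    {l : Submodule k (Fin 4 → k)} (hl : IsLine l) : p ∉ extend K l := by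
  obtain ⟨M, N, h⟩ := exists_isAdapted hl
  intro hpl
  rw [h.mem_extend_iff] at hpl
  have := hp.pair_eq_zero h.mul_inv 1 0 (by simp [hpl.1])
  exact one_ne_zero this.1

/-- In adapted coordinates the determinant at `(1, β, 0, 0)` is `(β ^ q - β) * (p' 2 * p' 3 ^ q - p'
3 * p' 2 ^ q)`. The first factor is nonzero for `β ∉ k`; if the second vanished, `p' 3 / p' 2` would
lie in `k` and `p` on a rational plane. -/
lemma IsGeneric.exists_eval_mooreForm_ne_zero [Finite k] [Infinite K] {p : Fin 4 → K}
    (hp : IsGeneric k p) {l : Submodule k (Fin 4 → k)} (hl : IsLine l) :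
    ∃ x ∈ extend K l, eval x (mooreForm (Nat.card k) p) ≠ 0 := by
  obtain ⟨M, N, h⟩ := exists_isAdapted hl
  obtain ⟨β, hβ⟩ := (Set.finite_range (algebraMap k K)).infinite_compl.nonempty
  have hβq : β ^ Nat.card k - β ≠ 0 := fun h0 =>
    hβ (mem_range_of_pow_card_eq k (sub_eq_zero.1 h0))
  refine ⟨emb k K (M 0) + β • emb k K (M 1), Submodule.add_mem _
    (emb_mem_extend K h.row_zero_mem) (Submodule.smul_mem _ _ (emb_mem_extend K h.row_one_mem)), ?_⟩
  intro h0
  set p' := Matrix.vecMul p (N.map (algebraMap k K)) with hp'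
  have hfrob : ∀ x : Fin 4 → K, Matrix.vecMul (fun i => x i ^ Nat.card k)
      (N.map (algebraMap k K)) =
        fun i => Matrix.vecMul x (N.map (algebraMap k K)) i ^ Nat.card k := by
    intro x
    ext i
    simp only [← frob_apply k, Matrix.vecMul, dotProduct, map_sum, map_mul, Matrix.map_apply,
      AlgHom.commutes]
  have hx : Matrix.vecMul (emb k K (M 0) + β • emb k K (M 1)) (N.map (algebraMap k K)) =
      ![1, β, 0, 0] := by
    ext i
    simp only [Matrix.add_vecMul, Matrix.smul_vecMul, Pi.add_apply, Pi.smul_apply, h.vecMul_row]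
    fin_cases i <;> simp
  have hmul : ∀ a b c d : Fin 4 → K, Matrix.of ![a, b, c, d] * N.map (algebraMap k K) =
      Matrix.of ![Matrix.vecMul a (N.map (algebraMap k K)),
        Matrix.vecMul b (N.map (algebraMap k K)), Matrix.vecMul c (N.map (algebraMap k K)),
        Matrix.vecMul d (N.map (algebraMap k K))] := by
    intro a b c d
    ext i j
    fin_cases i <;> rfl
  rw [eval_mooreForm] at h0
  have h1 := congrArg (· * (N.map (algebraMap k K)).det) h0
  simp only [zero_mul] at h1
  rw [← Matrix.det_mul, hmul, hfrob, hfrob, hx, ← hp'] at h1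
  have hq0 : Nat.card k ≠ 0 := Nat.card_pos.ne'
  have h2 : (β ^ Nat.card k - β) * (p' 2 * p' 3 ^ Nat.card k - p' 3 * p' 2 ^ Nat.card k) = 0 := by
    rw [← h1]
    simp [Matrix.det_succ_row_zero, Fin.sum_univ_succ, Fin.succAbove, hq0]
    ring
  have h3 := (mul_eq_zero.1 h2).resolve_left hβq
  have hp2 : p' 2 ≠ 0 := by
    intro h2
    have := hp.pair_eq_zero h.mul_inv 1 0 (by simp [← hp', h2])
    exact one_ne_zero this.1
  obtain ⟨c, hc⟩ := mem_range_of_pow_card_eq k (x := p' 3 / p' 2) (by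
    rw [div_pow, div_eq_div_iff (pow_ne_zero _ hp2) hp2]
    linear_combination h3)
  have := hp.pair_eq_zero h.mul_inv (-c) 1 (by
    rw [← hp', map_neg, hc, map_one]
    field_simp
    ring)
  exact one_ne_zero this.2

/-- The projection of the vector `x` from `p` to the hyperplane with equation `h`. -/
def projVec (p h x : Fin 4 → K) : Fin 4 → K := x - (h ⬝ᵥ x / h ⬝ᵥ p) • p

lemma dotProduct_projVec {p h : Fin 4 → K} (hhp : h ⬝ᵥ p ≠ 0) (x : Fin 4 → K) :
    h ⬝ᵥ projVec p h x = 0 := by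
  rw [projVec, dotProduct_sub, dotProduct_smul, smul_eq_mul, div_mul_cancel₀ _ hhp, sub_self]

lemma projVec_add (p h x y : Fin 4 → K) :
    projVec p h (x + y) = projVec p h x + projVec p h y := by
  simp only [projVec, dotProduct_add, add_div, add_smul]
  abel

lemma projVec_smul (p h x : Fin 4 → K) (a : K) :
    projVec p h (a • x) = a • projVec p h x := by
  simp only [projVec, dotProduct_smul, smul_eq_mul, mul_div_assoc, smul_sub, smul_smul]

lemma eval_projVec_mooreForm [Finite k] (p h x : Fin 4 → K) :
    eval (projVec p h x) (mooreForm (Nat.card k) p) = eval x (mooreForm (Nat.card k) p) := by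
  rw [projVec, sub_eq_add_neg, ← neg_smul, eval_add_smul_mooreForm]

/-- In the section by a plane `h` of the plane spanned by a generic point and a rational line,
the Moore form generates the ideal of the projections of the rational points of the line. -/
lemma IsGeneric.exists_eval_eq_mooreForm_mul [Finite k] [Infinite K] {p : Fin 4 → K}
    (hp : IsGeneric k p) {l : Submodule k (Fin 4 → k)} (hl : IsLine l) {h : Fin 4 → K}
    (hhp : h ⬝ᵥ p ≠ 0) (u : CoordRing K)
    (hu : ∀ v ∈ l, v ≠ 0 → ∀ t : K, eval (t • projVec p h (emb k K v)) u = 0) :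
    ∃ r : CoordRing K, ∀ x, h ⬝ᵥ x = 0 → x ∈ Submodule.span K {p} ⊔ extend K l →
      eval x u = eval x (mooreForm (Nat.card k) p) * eval x r := by
  obtain ⟨M, N, hMN⟩ := exists_isAdapted hl
  obtain ⟨w, hw, hFw⟩ := hp.exists_eval_mooreForm_ne_zero hl
  let := Fintype.ofFinite (Projectivization k l)
  let W : Submodule K (Fin 4 → K) := Submodule.span K
    (Set.range ![projVec p h (emb k K (M 0)), projVec p h (emb k K (M 1))])
  have hWp : ∀ x ∈ extend K l, projVec p h x ∈ W := by
    intro x hx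
    rw [hMN.mem_extend_iff] at hx
    rw [hMN.eq_sum x, Fin.sum_univ_four, hx.1, hx.2, zero_smul, zero_smul, add_zero, add_zero,
      projVec_add, projVec_smul, projVec_smul]
    exact W.add_mem (W.smul_mem _ (Submodule.subset_span ⟨0, rfl⟩))
      (W.smul_mem _ (Submodule.subset_span ⟨1, rfl⟩))
  have hW : finrank K W ≤ 2 := finrank_range_le_card _
  have hdiff : ∀ x, x - projVec p h x ∈ Submodule.span K {p} := by
    intro x
    rw [projVec, sub_sub_cancel]
    exact Submodule.smul_mem _ _ (Submodule.mem_span_singleton_self p)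
  -- Projection from `p` is injective on the extended line, which does not contain `p`; hence the
  -- projected points stay nonzero and distinct.
  have hindep : ∀ x ∈ extend K l, projVec p h x = 0 → x = 0 := by
    intro x hx h0
    have h1 := hdiff x
    rw [h0, sub_zero] at h1
    obtain ⟨a, rfl⟩ := Submodule.mem_span_singleton.1 h1
    by_cases ha : a = 0
    · rw [ha, zero_smul]
    · exact absurd (((extend K l).smul_mem_iff ha).1 hx) (hp.notMem_extend hl)
  have hrep0 : ∀ j : Projectivization k l, (j.rep : Fin 4 → k) ≠ 0 := fun j h0 =>
    j.rep_nonzero (Subtype.ext h0)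
  obtain ⟨r, hr⟩ := exists_eval_eq_mul_of_eval_points (J := Projectivization k l) W hW
    (fun j => projVec p h (emb k K j.rep)) (fun j => hWp _ (emb_mem_extend K j.rep.2))
    (fun j h0 => emb_ne_zero K (hrep0 j) (hindep _ (emb_mem_extend K j.rep.2) h0))
    (by
      intro i j hij hmem
      obtain ⟨a, ha⟩ := Submodule.mem_span_singleton.1 hmem
      rw [← projVec_smul, ← sub_eq_zero, sub_eq_add_neg, ← neg_one_smul K, ← projVec_smul,
        ← projVec_add, neg_one_smul, ← sub_eq_add_neg] at ha
      have h1 := sub_eq_zero.1 (hindep _ (Submodule.sub_mem _ (Submodule.smul_mem _ _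
        (emb_mem_extend K j.rep.2)) (emb_mem_extend K i.rep.2)) ha)
      obtain ⟨c, hc⟩ := exists_smul_eq_of_smul_emb K (hrep0 j) h1
      refine hij ?_
      rw [← i.mk_rep, ← j.mk_rep, Projectivization.mk_eq_mk_iff']
      exact ⟨c, Subtype.ext hc⟩)
    (mooreForm (Nat.card k) p) (by
      rw [← Nat.card_eq_fintype_card, Projectivization.card_of_finrank_two k l hl]
      exact isHomogeneous_mooreForm _ _)
    (fun j => by rw [eval_projVec_mooreForm, eval_emb_mooreForm])
    (projVec p h w) (hWp w hw) (by rwa [eval_projVec_mooreForm]) u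
    (fun j t => hu _ j.rep.2 (hrep0 j) t)
  -- A vector `a • p + z` of the hyperplane `h` is the projection of its component `z`.
  refine ⟨r, fun x hhx hx => hr x ?_⟩
  obtain ⟨y, hy, z, hz, rfl⟩ := Submodule.mem_sup.1 hx
  obtain ⟨a, rfl⟩ := Submodule.mem_span_singleton.1 hy
  convert hWp z hz
  rw [dotProduct_add, dotProduct_smul, smul_eq_mul] at hhx
  rw [projVec, sub_eq_neg_add, ← neg_smul]
  congr 2
  field_simp
  linear_combination hhx

end Generic

/-! ### Criteria for cones -/

section Cones

variable {K : Type*} [Field K]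

lemma linForm_mem_homogeneousIdeal {P : P3 K} {c : Fin 4 → K} (h : c ⬝ᵥ P.rep = 0) :
    linForm c ∈ homogeneousIdeal {P} := by
  refine Ideal.subset_span ⟨⟨1, isHomogeneous_linForm c⟩, ?_⟩
  rintro _ rfl
  rw [VanishesAt, eval_linForm, h]

/-- A form invariant under translations by multiples of a vector is the equation of a cone. -/
lemma isCone_of_eval_add_smul [Infinite K] {F : CoordRing K} {P : P3 K} {d : ℕ} (h0 : F ≠ 0)
    (hF : F.IsHomogeneous d) (hinv : ∀ x (a : K), eval (x + a • P.rep) F = eval x F) :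
    IsCone F P d := by
  classical
  refine ⟨h0, hF, ?_⟩
  obtain ⟨i, hi⟩ := Function.ne_iff.1 P.rep_nonzero
  -- The forms `X j - (p j / p i) * X i`, where `p = P.rep`, vanish at `P`. Translating `x` until
  -- its `i`-th coordinate is zero shows that `F` is unchanged when they are substituted for the
  -- variables.
  let g : Fin 4 → (Fin 4 → K) := fun j => Pi.single j 1 - Pi.single i (P.rep j / P.rep i)
  have hFg : F = aeval (fun j => linForm (g j)) F := by
    refine MvPolynomial.funext fun x => ?_
    rw [eval_aeval, ← hinv x (-(x i / P.rep i))]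
    congr 2
    ext j
    simp only [g, eval_linForm, sub_dotProduct, single_dotProduct, Pi.add_apply, Pi.smul_apply,
      smul_eq_mul]
    ring
  rw [hFg]
  refine aeval_mem_pow _ _ (fun j => linForm_mem_homogeneousIdeal ?_) hF
  simp only [g, sub_dotProduct, single_dotProduct]
  rw [Pi.zero_apply] at hi
  field_simp
  ring

lemma isCone_prod_linForm {ι : Type*} (s : Finset ι) (L : ι → Fin 4 → K) {P : P3 K}
    (h0 : ∀ i ∈ s, linForm (L i) ≠ 0) (hP : ∀ i ∈ s, L i ⬝ᵥ P.rep = 0) :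
    IsCone (∏ i ∈ s, linForm (L i)) P s.card := by
  refine ⟨Finset.prod_ne_zero_iff.2 h0, ?_, ?_⟩
  · rw [Finset.card_eq_sum_ones]
    exact IsHomogeneous.prod _ _ _ fun i _ => isHomogeneous_linForm _
  · rw [← Finset.prod_const]
    exact Ideal.prod_mem_prod fun i hi => linForm_mem_homogeneousIdeal (hP i hi)

end Cones

end Geproci

namespace Geproci

open Module MvPolynomial

/-! ### The complete intersection and the half grid -/

section Main

variable {k K : Type*} [Field k] [Finite k] [Field K] [Algebra k K] [Infinite K]

lemma IsGeneric.isCone_mooreForm {P : P3 K} (hP : IsGeneric k P.rep)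
    {l : Submodule k (Fin 4 → k)} (hl : IsLine l) :
    IsCone (mooreForm (Nat.card k) P.rep) P (Nat.card k + 1) := by
  obtain ⟨x, -, hx⟩ := hP.exists_eval_mooreForm_ne_zero hl
  refine isCone_of_eval_add_smul ?_ (isHomogeneous_mooreForm _ _)
    fun x a => eval_add_smul_mooreForm k _ x a
  intro h0
  rw [h0, map_zero] at hx
  exact hx rfl

omit [Infinite K] in
lemma vanishesAt_mooreForm (P : P3 K) {Q : P3 K} (hQ : Q ∈ rationalPoints k K) :
    VanishesAt (mooreForm (Nat.card k) P.rep) Q := by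
  obtain ⟨v, hv, rfl⟩ := hQ
  exact (vanishesAt_mk_iff (isHomogeneous_mooreForm _ _) hv).2 (eval_emb_mooreForm P.rep v)

/-- The cone of degree `q ^ 2 + 1` over a spread with a generic vertex. -/
lemma IsGeneric.exists_cone_of_isSpread {P : P3 K} (hP : IsGeneric k P.rep)
    {S : Set (Submodule k (Fin 4 → k))} (hS : IsSpread S) :
    ∃ G : CoordRing K, IsCone G P (Nat.card k ^ 2 + 1) ∧
      {Q : P3 K | VanishesAt G Q} = join P S ∧
      (∀ Q ∈ rationalPoints k K, VanishesAt G Q) ∧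
      ∀ h : CoordRing K, h.IsHomogeneous 1 → ¬ VanishesAt h P →
        IsPlaneCompleteIntersectionOf h (projection P h (rationalPoints k K))
          (Nat.card k + 1) (Nat.card k ^ 2 + 1) (mooreForm (Nat.card k) P.rep) G := by
  classical
  have := Fintype.ofFinite S
  choose L hL hLv using fun l : S => hP.exists_plane (hS.1 l l.2)
  set G : CoordRing K := ∏ l, linForm (L l) with hG
  have hcard : (Finset.univ : Finset S).card = Nat.card k ^ 2 + 1 := by
    rw [Finset.card_univ, ← Nat.card_eq_fintype_card, Nat.card_coe_set_eq, hS.ncard]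
  have hLP : ∀ l, L l ⬝ᵥ P.rep = 0 := fun l =>
    (hL l _).2 (Submodule.mem_sup_left (Submodule.mem_span_singleton_self _))
  have hL0 : ∀ l, linForm (L l) ≠ 0 := by
    intro l h0
    have htop : (l : Submodule k (Fin 4 → k)) = ⊤ := eq_top_iff.2 fun v _ =>
      hLv l v (by rw [← eval_linForm, h0, map_zero])
    have h2 : finrank k (l : Submodule k (Fin 4 → k)) = 2 := hS.1 l l.2
    rw [htop, finrank_top, finrank_fin_fun] at h2
    omega
  have hcone : IsCone G P (Nat.card k ^ 2 + 1) := by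
    rw [← hcard]
    exact isCone_prod_linForm _ L (fun l _ => hL0 l) fun l _ => hLP l
  have hGeval : ∀ x, eval x G = ∏ l, L l ⬝ᵥ x := fun x => by
    simp only [hG, map_prod, eval_linForm]
  have hjoin : {Q : P3 K | VanishesAt G Q} = join P S := by
    ext Q
    rw [Set.mem_ofPred_eq, VanishesAt, hGeval, Finset.prod_eq_zero_iff]
    simp only [hL, ← Projectivization.submodule_eq, ← liesOn_iff_rep_mem]
    constructor
    · rintro ⟨l, -, hl⟩
      exact ⟨l, l.2, hl⟩
    · rintro ⟨l, hl, hQ⟩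
      exact ⟨⟨l, hl⟩, Finset.mem_univ _, hQ⟩
  have hmem : ∀ v : Fin 4 → k, v ≠ 0 → ∃ l : S, v ∈ l.1 := fun v hv => by
    obtain ⟨l, ⟨hl, hvl⟩, -⟩ := hS.existsUnique hv
    exact ⟨⟨l, hl⟩, hvl⟩
  have hLemb : ∀ (l : S) (v : Fin 4 → k), v ∈ l.1 → L l ⬝ᵥ emb k K v = 0 := fun l v hv =>
    (hL l _).2 (Submodule.mem_sup_right (emb_mem_extend K hv))
  have hGZ : ∀ v : Fin 4 → k, v ≠ 0 → eval (emb k K v) G = 0 := by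
    intro v hv
    obtain ⟨l, hvl⟩ := hmem v hv
    rw [hGeval]
    exact Finset.prod_eq_zero (Finset.mem_univ l) (hLemb l v hvl)
  have hGadd : ∀ x (a : K), eval (x + a • P.rep) G = eval x G := by
    intro x a
    simp only [hGeval, dotProduct_add, dotProduct_smul, hLP, smul_zero, add_zero]
  refine ⟨G, hcone, hjoin, ?_, ?_⟩
  · rintro _ ⟨v, hv, rfl⟩
    refine (vanishesAt_mk_iff hcone.2.1 hv).2 (hGZ v ?_)
    rintro rfl
    exact hv (map_zero (emb k K))
  intro h hh hhP
  obtain ⟨h, rfl⟩ := exists_eq_linForm hh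
  rw [VanishesAt, eval_linForm] at hhP
  set F := mooreForm (Nat.card k) P.rep with hF
  have hFh : F.IsHomogeneous (Nat.card k + 1) := isHomogeneous_mooreForm _ _
  refine ⟨hFh, hcone.2.1, le_antisymm (Ideal.span_le.2 ?_) (Ideal.span_le.2 ?_)⟩
  · rintro f ⟨⟨d, hf⟩, hfY⟩
    have hvan : ∀ v : Fin 4 → k, v ≠ 0 → ∀ t : K,
        eval (t • projVec P.rep h (emb k K v)) f = 0 := by
      intro v hv t
      rw [eval_smul_of_isHomogeneous hf]
      -- A rational vector projecting to zero would be proportional to `P.rep`, putting `P` on an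
      -- extended line of `S`.
      by_cases h0 : projVec P.rep h (emb k K v) = 0
      · obtain ⟨l, hvl⟩ := hmem v hv
        rw [projVec, sub_eq_zero] at h0
        by_cases ha : h ⬝ᵥ emb k K v / h ⬝ᵥ P.rep = 0
        · rw [ha, zero_smul] at h0
          exact absurd h0 (emb_ne_zero K hv)
        · refine absurd ?_ (hP.notMem_extend (hS.1 l l.2))
          rw [← (extend K l.1).smul_mem_iff ha, ← h0]
          exact emb_mem_extend K hvl
      · rw [(vanishesAt_mk_iff hf h0).1 (hfY _ ⟨?_, _, mk_emb_mem K v (emb_ne_zero K hv), ?_⟩),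
          mul_zero]
        · rw [vanishesAt_mk_iff hh, eval_linForm, dotProduct_projVec hhP]
        · rw [liesOn_mk_iff, Projectivization.submodule_mk, Projectivization.submodule_eq, projVec]
          exact Submodule.sub_mem _
            (Submodule.mem_sup_right (Submodule.mem_span_singleton_self _))
            (Submodule.smul_mem _ _
              (Submodule.mem_sup_left (Submodule.mem_span_singleton_self _)))
    obtain ⟨r, s, hrs⟩ := exists_eval_eq_add_prod_mul h F L
      (fun l => {y | ∃ v ∈ l.1, v ≠ 0 ∧ y = projVec P.rep h (emb k K v)}) Finset.univ
      (fun l _ u hu => by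
        obtain ⟨r, hr⟩ := hP.exists_eval_eq_mooreForm_mul (hS.1 l l.2) hhP u
          fun v hv hv0 t => hu _ ⟨v, hv, hv0, rfl⟩ t
        exact ⟨r, fun x hx hLx => hr x hx ((hL l x).1 hLx)⟩)
      (by
        -- `L l'` kills `P.rep`, so it takes the same value on `v` and on its projection; vanishing
        -- would put `v` on two lines of the spread.
        rintro l - l' - hne _ ⟨v, hv, hv0, rfl⟩ h0
        rw [projVec, dotProduct_sub, dotProduct_smul, hLP, smul_zero, sub_zero] at h0
        exact hne (Subtype.ext ((hS.existsUnique hv0).unique ⟨l.2, hv⟩ ⟨l'.2, hLv l' v h0⟩)))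
      (by
        rintro l - _ ⟨v, -, -, rfl⟩
        exact dotProduct_projVec hhP _)
      (by
        rintro l - _ ⟨v, -, -, rfl⟩ t
        rw [eval_smul_of_isHomogeneous hFh, eval_projVec_mooreForm, eval_emb_mooreForm, mul_zero])
      f (by
        rintro l - _ ⟨v, -, hv0, rfl⟩ t
        exact hvan v hv0 t)
    -- The remainder vanishes on `h = 0`, hence is divisible by `h`.
    obtain ⟨t, ht⟩ := exists_eq_linForm_mul h (f - F * r - G * s) fun x hx => by
      rw [map_sub, map_sub, map_mul, map_mul, hrs x hx, hGeval]
      ring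
    have hft : f = t * linForm h + r * F + s * G := by linear_combination ht
    rw [SetLike.mem_coe, hft]
    exact Ideal.add_mem _ (Ideal.add_mem _
      (Ideal.mul_mem_left _ _ (Ideal.subset_span (by simp)))
      (Ideal.mul_mem_left _ _ (Ideal.subset_span (by simp))))
      (Ideal.mul_mem_left _ _ (Ideal.subset_span (by simp)))
  -- For the easy inclusion, a projected point is a rational vector up to scaling and translation
  -- along `P.rep`, and `F` and `G` do not see the translation.
  · have hR : ∀ R ∈ projection P (linForm h) (rationalPoints k K), ∃ v : Fin 4 → k, v ≠ 0 ∧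
        ∃ a b : K, R.rep = b • emb k K v + a • P.rep := by
      rintro R ⟨-, _, ⟨v, hv, rfl⟩, hRQ⟩
      refine ⟨v, ?_, ?_⟩
      · rintro rfl
        exact hv (map_zero (emb k K))
      · rw [liesOn_iff_rep_mem, Projectivization.submodule_mk, Projectivization.submodule_eq,
          ← Submodule.span_insert, Submodule.mem_span_pair] at hRQ
        obtain ⟨a, b, hab⟩ := hRQ
        refine ⟨a, b, ?_⟩
        rw [← hab, add_comm]
        rfl
    rintro f (rfl | rfl | rfl)
    · exact Ideal.subset_span ⟨⟨1, hh⟩, fun R hR => hR.1⟩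
    · refine Ideal.subset_span ⟨⟨_, hFh⟩, fun R hRY => ?_⟩
      obtain ⟨v, -, a, b, hab⟩ := hR R hRY
      rw [VanishesAt, hab, eval_add_smul_mooreForm, eval_smul_of_isHomogeneous hFh,
        eval_emb_mooreForm, mul_zero]
    · refine Ideal.subset_span ⟨⟨_, hcone.2.1⟩, fun R hRY => ?_⟩
      obtain ⟨v, hv, a, b, hab⟩ := hR R hRY
      rw [VanishesAt, hab, hGadd, eval_smul_of_isHomogeneous hcone.2.1, hGZ v hv, mul_zero]

omit [Infinite K] in
lemma IsPlaneCompleteIntersectionOf.symm {h : CoordRing K} {Y : Set (P3 K)} {a b : ℕ}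
    {F G : CoordRing K} (H : IsPlaneCompleteIntersectionOf h Y a b F G) :
    IsPlaneCompleteIntersectionOf h Y b a G F := by
  refine ⟨H.2.1, H.1, ?_⟩
  rw [H.2.2, Set.pair_comm]

omit [Infinite K] in
lemma IsGeproci.symm {Z : Set (P3 K)} {a b : ℕ} (H : IsGeproci Z a b) : IsGeproci Z b a := by
  obtain ⟨hZ, ha, hb, C, hC, hC', H⟩ := H
  refine ⟨hZ, hb, ha, C, hC, hC', fun P hP h hh hhP => ?_⟩
  obtain ⟨F, G, hFG⟩ := H P hP h hh hhP
  exact ⟨G, F, hFG.symm⟩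

variable (k K)

lemma isGeproci_rationalPoints :
    IsGeproci (rationalPoints k K) (Nat.card k + 1) (Nat.card k ^ 2 + 1) := by
  obtain ⟨S, hS⟩ := exists_isSpread k
  refine ⟨finite_rationalPoints K, Nat.succ_pos _, Nat.succ_pos _,
    forGeneralPoint_of_isGeneric k fun P hP h hh hhP => ?_⟩
  obtain ⟨G, -, -, -, hG⟩ := hP.exists_cone_of_isSpread hS
  exact ⟨_, G, hG h hh hhP⟩

lemma isHalfGrid_rationalPoints :
    IsHalfGrid (rationalPoints k K) (Nat.card k ^ 2 + 1) (Nat.card k + 1) := by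
  classical
  refine ⟨isNontrivial_rationalPoints k K, (isGeproci_rationalPoints k K).symm, ?_⟩
  obtain ⟨S, hS⟩ := exists_isSpread k
  have hfin : (extend K '' S).Finite := (Set.toFinite S).image _
  have hinj : Set.InjOn (extend K) S := fun l hl l' hl' h =>
    extend_injOn K (hS.1 l hl) (hS.1 l' hl') h
  refine ⟨hfin.toFinset, ?_, ?_, ?_, ?_, ?_⟩
  · rw [← Set.ncard_eq_toFinset_card _ hfin, hinj.ncard_image, hS.ncard]
  · intro m hm
    obtain ⟨l, hl, rfl⟩ := hfin.mem_toFinset.1 hm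
    exact isLine_extend K (hS.1 l hl)
  · intro m hm m' hm' hne
    obtain ⟨l, hl, rfl⟩ := hfin.mem_toFinset.1 hm
    obtain ⟨l', hl', rfl⟩ := hfin.mem_toFinset.1 hm'
    exact disjoint_extend K (hS.1 l hl) (hS.1 l' hl')
      (hS.disjoint hl hl' fun h => hne (congrArg _ h))
  · rintro _ ⟨v, hv, rfl⟩
    have hv0 : v ≠ 0 := by
      rintro rfl
      exact hv (map_zero (emb k K))
    obtain ⟨l, ⟨hl, hvl⟩, -⟩ := hS.existsUnique hv0
    exact ⟨extend K l, hfin.mem_toFinset.2 ⟨l, hl, rfl⟩,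
      (liesOn_mk_iff hv _).2 (emb_mem_extend K hvl)⟩
  · intro m hm
    obtain ⟨l, hl, rfl⟩ := hfin.mem_toFinset.1 hm
    exact ncard_rationalPoints_liesOn_extend K (hS.1 l hl)

end Main

end Geproci

theorem theorem1 (q : ℕ) (hq : IsPrimePow q)
    (k : Type*) [Field k] (hk : Nat.card k = q)
    (K : Type*) [Field K] [Algebra k K] [IsAlgClosure k K] :
    -- `(q + 1, q ^ 2 + 1)`-geproci
    (q + 1 ≤ q ^ 2 + 1 ∧
      Geproci.IsGeproci (Geproci.rationalPoints k K) (q + 1) (q ^ 2 + 1)) ∧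
    -- a half grid: `q ^ 2 + 1` skew lines with `q + 1` points each
    Geproci.IsHalfGrid (Geproci.rationalPoints k K) (q ^ 2 + 1) (q + 1) ∧
    -- the two curves, as plane sections of explicit cones
    (∃ S : Set (Submodule k (Fin 4 → k)), Geproci.IsSpread S) ∧
    ∀ S : Set (Submodule k (Fin 4 → k)), Geproci.IsSpread S →
      S.ncard = q ^ 2 + 1 ∧
      Geproci.ForGeneralPoint fun P : Geproci.P3 K =>
        Geproci.IsCone (Geproci.mooreForm q P.rep) P (q + 1) ∧
        (∀ Q ∈ Geproci.rationalPoints k K,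
          Geproci.VanishesAt (Geproci.mooreForm q P.rep) Q) ∧
        ∃ G : Geproci.CoordRing K,
          Geproci.IsCone G P (q ^ 2 + 1) ∧
          {Q : Geproci.P3 K | Geproci.VanishesAt G Q} = Geproci.join P S ∧
          (∀ Q ∈ Geproci.rationalPoints k K, Geproci.VanishesAt G Q) ∧
          ∀ h : Geproci.CoordRing K, h.IsHomogeneous 1 → ¬ Geproci.VanishesAt h P →
            Geproci.IsPlaneCompleteIntersectionOf h
              (Geproci.projection P h (Geproci.rationalPoints k K))
              (q + 1) (q ^ 2 + 1) (Geproci.mooreForm q P.rep) G := by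
  subst hk
  have : Finite k := Nat.finite_of_card_ne_zero hq.ne_zero
  have : IsAlgClosed K := IsAlgClosure.isAlgClosed k
  refine ⟨⟨Nat.succ_le_succ (Nat.le_self_pow two_ne_zero _),
    Geproci.isGeproci_rationalPoints k K⟩, Geproci.isHalfGrid_rationalPoints k K,
    Geproci.exists_isSpread k, fun S hS => ⟨hS.ncard, ?_⟩⟩
  refine Geproci.forGeneralPoint_of_isGeneric k fun P hP =>
    ⟨?_, fun Q hQ => Geproci.vanishesAt_mooreForm P hQ, hP.exists_cone_of_isSpread hS⟩
  -- Any line of `S` serves to show the Moore form nonzero; the all-ones vector only supplies one.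
  obtain ⟨l, ⟨hl, -⟩, -⟩ := hS.existsUnique (one_ne_zero : (1 : Fin 4 → k) ≠ 0)
  exact hP.isCone_mooreForm (hS.1 l hl)
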